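/- Let $m\ge 0$, let $\omega_0,\dots,\omega_m\ge 0$ be integers and let $a_0=1,a_1,\dots,a_m$ be positive integers such that $\mathbb P(1,a_1,\dots,a_m)$ is well-formed, i.e. $\gcd(a_0,\dots,\widehat{a_i},\dots,a_m)=1$ for every $i$ (so $m\ge1$). Let $\mathcal F$ be the weighted bundle over $\mathbb P^1$, i.e. the quotient variety $(\mathbb C^{m+3}-V(I))/(\mathbb C^*)^2$ with Cox ring $\mathbb C[x_0,x_1,y_0,\dots,y_m]$, irrelevant ideal $I=(x_0,x_1)\cap(y_0,\dots,y_m)$ and weights $$\begin{pmatrix}1&1&-\omega_0&\cdots&-\omega_m\\0&0&a_0&\cdots&a_m\end{pmatrix}.$$ Fix $k\in\{0,\dots,m\}$ and strictly positive integers $b_0,\dots,b_m$ with $b_i\equiv a_i \pmod{a_k}$ for $i\ne k$ and $b_k=r a_k$ for some positive integer $r$. Let $T=[(\mathbb C^{m+4}-V(J))/(\mathbb C^*)^3]$ be the toric stack with Cox ring $\mathbb C[X_0,X_1,Y_0,\dots,Y_m,\xi]$, irrelevant ideal $$J=(X_0,X_1)\cap(Y_0,\dots,Y_m)\cap(\xi,X_1)\cap(\xi,Y_k)\cap(X_0,Y_0,\dots,\widehat{Y_k},\dots,Y_m)$$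 and weight matrix $$\begin{pmatrix}1&1&-\omega_0&\cdots&-\omega_k&\cdots&-\omega_m&0\\0&0&a_0&\cdots&a_k&\cdots&a_m&0\\ b_k&0&b_0&\cdots&0&\cdots&b_m&-a_k\end{pmatrix}.$$ Then $T$ has rank $3$ and is the toric weighted blow up of $\mathcal F$ at the point $p=(0:1;0:\dots:1:\dots:0)$ (with $y_k=1$), in the following sense. (1) Let $\alpha_1,\beta_1,\dots,\beta_m$ be the standard basis of $\mathbb Z^{m+1}$, $\beta_0=-\sum_{i\ge1}a_i\beta_i$ and $\alpha_0=-\alpha_1+\sum_{i\ge0}\omega_i\beta_i$. The cones spanned by all of the $\alpha$'s and $\beta$'s except one $\alpha_s$ and one $\beta_j$, with their faces, form a simplicial fan $\Sigma$. Its irrelevant ideal is $I$, and the group $\{t\in(\mathbb C^*)^{m+3}:\prod_\rho t_\rho^{\langle e,u_\rho\rangle}=1 \text{ for all } e\in\operatorname{Hom}(\mathbb Z^{m+1},\mathbb Z)\}$ of its quotient construction (where $u_\rho$ runs over the given ray vectors) is the faithful image of $(\mathbb C^*)^2$ under the weights of $\mathcal F$. So $\mathcal F$ is the toric variety of $\Sigma$.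 (2) There is $\gamma\in\mathbb Z^{m+1}$ with $a_k\gamma=b_k\alpha_0+\sum_{i\ne k}b_i\beta_i$, a vector in the interior of the cone of $p$. The star subdivision of $\Sigma$ at $\gamma$ is a simplicial fan. Its irrelevant ideal, with $X_s,Y_i,\xi$ corresponding to $\alpha_s,\beta_i,\gamma$, is $J$. The group of its quotient construction, formed with the vectors $\alpha_s,\beta_i,\gamma$, is the image of $(\mathbb C^*)^3$ under the weights of $T$. The kernel of this action of $(\mathbb C^*)^3$ (the generic stabiliser of $T$) is cyclic of order $a_k$. So the coarse moduli space $(\mathbb C^{m+4}-V(J))/(\mathbb C^*)^3$ of $T$ is the toric variety of the star subdivision. (3) The rule $$(X_0,X_1,Y_0,\dots,Y_m,\xi)\mapsto(X_0\xi^{b_k/a_k}:X_1;\ \dots:Y_i\xi^{b_i/a_k}:\dots:Y_k:\dots)$$ (for any choice of $\xi^{1/a_k}$, the same in all coordinates) defines a morphism $\pi$ from the coarse moduli space of $T$ to $\mathcal F$. It is surjective, it is an isomorphism over $\mathcal F-\{p\}$, and $\pi^{-1}(p)=\{\xi=0\}$. The open set $\{x_1y_k\ne0\}\ni p$ is identified,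 by setting $x_1=y_k=1$, with the cyclic quotient singularity $\mathbb C^{m+1}/\mu_{a_k}$ of type $\frac1{a_k}(0,a_0,\dots,\widehat{a_k},\dots,a_m)$ in the coordinates $x_0,y_i$ $(i\ne k)$, with $p$ at the origin, and over it $\pi$ is the weighted blow up of the origin with weights $\frac1{a_k}(b_k,b_0,\dots,\widehat{b_k},\dots,b_m)$. Here the weighted blow up of $\mathbb C^{m+1}/\mu_{a_k}$ with weights $\frac1{a_k}(b)$ is the quotient by $\mu_{a_k}$ of the weighted blow up $((\mathbb C^{m+1}-0)\times\mathbb C)/\mathbb C^*\to\mathbb C^{m+1}$, $(z,u)\mapsto(u^{b_v}z_v)_v$, where $t\in\mathbb C^*$ acts by $(t^{b_v}z_v,t^{-1}u)$, and $\mu_{a_k}$ acts on the coordinates $z$ with the weights of the singularity and trivially on $u$. -/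

import Mathlib

open MvPolynomial

namespace ToricBlowUp

/-! ### Complex varieties as spaces with functions -/

/-- A space with functions over `ℂ`: a topological space with a sheaf of `ℂ`-algebras of complex
valued functions. A function on an open set `U` is represented by a total function, of which only
the restriction to `U` matters. -/
structure SpaceWithFunctions where
  carrier : Type
  [top : TopologicalSpace carrier]
  /-- `reg U` is the set of functions that are regular on the open set `U`. -/
  reg : Set carrier → Set (carrier → ℂ)
  const_mem : ∀ U : Set carrier, IsOpen U → ∀ c : ℂ, (fun _ => c) ∈ reg U
  add_mem : ∀ U : Set carrier, IsOpen U → ∀ f ∈ reg U, ∀ g ∈ reg U, f + g ∈ reg U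
  mul_mem : ∀ U : Set carrier, IsOpen U → ∀ f ∈ reg U, ∀ g ∈ reg U, f * g ∈ reg U
  mem_iff_locally : ∀ U : Set carrier, IsOpen U → ∀ f : carrier → ℂ, f ∈ reg U ↔
    ∀ x ∈ U, ∃ V : Set carrier, IsOpen V ∧ x ∈ V ∧ V ⊆ U ∧ ∃ g ∈ reg V, Set.EqOn f g V

instance : CoeSort SpaceWithFunctions Type := ⟨SpaceWithFunctions.carrier⟩

instance (X : SpaceWithFunctions) : TopologicalSpace X := X.top

/-- Morphisms: continuous maps that pull regular functions back to regular functions. -/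
def IsMorphism {X Y : SpaceWithFunctions} (f : X → Y) : Prop :=
  Continuous f ∧ ∀ V : Set Y, IsOpen V → ∀ g ∈ Y.reg V, g ∘ f ∈ X.reg (f ⁻¹' V)

/-- The restriction of the morphism `f` to the open set `W` is an open immersion, that is, an
isomorphism of `W` onto an open subspace of the target. -/
def IsOpenImmersionOn {X Y : SpaceWithFunctions} (f : X → Y) (W : Set X) : Prop :=
  IsMorphism f ∧ IsOpen W ∧ Set.InjOn f W ∧
    ∀ V : Set X, IsOpen V → V ⊆ W →
      IsOpen (f '' V) ∧ ∀ g ∈ X.reg V, ∃ h ∈ Y.reg (f '' V), ∀ x ∈ V, h (f x) = g x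

/-- The quotient of a space with functions by an equivalence relation: the quotient topology, and
the functions that become regular upstairs. -/
def SpaceWithFunctions.quotient (X : SpaceWithFunctions) (s : Setoid X) : SpaceWithFunctions where
  carrier := Quotient s
  top := inferInstance
  reg U := {f | f ∘ Quotient.mk s ∈ X.reg (Quotient.mk s ⁻¹' U)}
  const_mem U hU c := X.const_mem _ (hU.preimage continuous_quotient_mk') c
  add_mem U hU f hf g hg := X.add_mem _ (hU.preimage continuous_quotient_mk') _ hf _ hg
  mul_mem U hU f hf g hg := X.mul_mem _ (hU.preimage continuous_quotient_mk') _ hf _ hg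
  mem_iff_locally U hU f := by
    constructor
    · exact fun hf x hx => ⟨U, hU, hx, subset_rfl, f, hf, fun _ _ => rfl⟩
    · intro h
      refine (X.mem_iff_locally _ (hU.preimage continuous_quotient_mk') _).2 fun z hz => ?_
      obtain ⟨V, hV, hzV, hVU, g, hg, hfg⟩ := h _ hz
      exact ⟨Quotient.mk s ⁻¹' V, hV.preimage continuous_quotient_mk', hzV,
        Set.preimage_mono hVU, g ∘ Quotient.mk s, hg, fun w hw => hfg hw⟩

/-- The Zariski topology on a subset of the affine space `ℂ^ι`. -/
@[reducible]
def zariskiTopology {ι : Type} (Z : Set (ι → ℂ)) : TopologicalSpace Z :=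
  TopologicalSpace.generateFrom
    (Set.range fun P : MvPolynomial ι ℂ => {z : Z | eval z.1 P ≠ 0})

/-- A subset `Z` of the affine space `ℂ^ι`, with the Zariski topology and with the functions that
are locally quotients of polynomials. -/
def zariskiSpace {ι : Type} (Z : Set (ι → ℂ)) : SpaceWithFunctions :=
  letI : TopologicalSpace Z := zariskiTopology Z
  { carrier := Z
    reg := fun U => {f | ∀ z ∈ U, ∃ V : Set Z, IsOpen V ∧ z ∈ V ∧ V ⊆ U ∧
      ∃ P Q : MvPolynomial ι ℂ, ∀ w ∈ V, eval w.1 Q ≠ 0 ∧ f w = eval w.1 P / eval w.1 Q}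
    const_mem := fun U hU c z hz =>
      ⟨U, hU, hz, subset_rfl, C c, 1, fun w _ => by simp⟩
    add_mem := fun U _ f hf g hg z hz => by
      obtain ⟨V, hV, hzV, hVU, P, Q, h⟩ := hf z hz
      obtain ⟨V', hV', hzV', _, P', Q', h'⟩ := hg z hz
      refine ⟨V ∩ V', hV.inter hV', ⟨hzV, hzV'⟩, Set.inter_subset_left.trans hVU,
        P * Q' + Q * P', Q * Q', fun w hw => ?_⟩
      obtain ⟨h1, h2⟩ := h w hw.1
      obtain ⟨h3, h4⟩ := h' w hw.2
      refine ⟨by simp [h1, h3], ?_⟩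
      simp only [Pi.add_apply, h2, h4, map_add, map_mul, div_add_div _ _ h1 h3]
    mul_mem := fun U _ f hf g hg z hz => by
      obtain ⟨V, hV, hzV, hVU, P, Q, h⟩ := hf z hz
      obtain ⟨V', hV', hzV', _, P', Q', h'⟩ := hg z hz
      refine ⟨V ∩ V', hV.inter hV', ⟨hzV, hzV'⟩, Set.inter_subset_left.trans hVU,
        P * P', Q * Q', fun w hw => ?_⟩
      obtain ⟨h1, h2⟩ := h w hw.1
      obtain ⟨h3, h4⟩ := h' w hw.2
      refine ⟨by simp [h1, h3], ?_⟩
      simp only [Pi.mul_apply, h2, h4, map_mul, div_mul_div_comm]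
    mem_iff_locally := fun U hU f => by
      constructor
      · exact fun hf x hx => ⟨U, hU, hx, subset_rfl, f, hf, fun _ _ => rfl⟩
      · intro h z hz
        obtain ⟨V, _, hzV, hVU, g, hg, hfg⟩ := h z hz
        obtain ⟨V', hV', hzV', hVV', P, Q, hPQ⟩ := hg z hzV
        exact ⟨V', hV', hzV', hVV'.trans hVU, P, Q, fun w hw =>
          ⟨(hPQ w hw).1, by rw [hfg (hVV' hw)]; exact (hPQ w hw).2⟩⟩ }

/-! ### Quotients of open subsets of affine space by groups of diagonal matrices -/

/-- The complement in `ℂ^ι` of the zero set of the ideal `I`. -/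
def stableLocus {ι : Type} (I : Ideal (MvPolynomial ι ℂ)) : Set (ι → ℂ) := (zeroLocus ℂ I)ᶜ

/-- Two points of `ℂ^ι - V(I)` are equivalent if an element of `G ⊆ (ℂ^*)^ι` maps one of them to
the other. -/
def orbitSetoid {ι : Type} (I : Ideal (MvPolynomial ι ℂ)) (G : Subgroup (ι → ℂˣ)) :
    Setoid (zariskiSpace (stableLocus I)) where
  r z w := ∃ t ∈ G, ∀ i, w.1 i = (t i : ℂ) * z.1 i
  iseqv :=
    { refl := fun z => ⟨1, G.one_mem, by simp⟩
      symm := by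
        rintro z w ⟨t, ht, h⟩
        exact ⟨t⁻¹, G.inv_mem ht, fun i => by simp [h i]⟩
      trans := by
        rintro z w v ⟨t, ht, h⟩ ⟨t', ht', h'⟩
        exact ⟨t' * t, G.mul_mem ht' ht, fun i => by
          simp only [h', h, Pi.mul_apply, Units.val_mul, mul_assoc]⟩ }

/-- The quotient `(ℂ^ι - V(I)) / G` for a group `G ⊆ (ℂ^*)^ι` of diagonal matrices. -/
def quotientSpace {ι : Type} (I : Ideal (MvPolynomial ι ℂ)) (G : Subgroup (ι → ℂˣ)) :
    SpaceWithFunctions :=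
  (zariskiSpace (stableLocus I)).quotient (orbitSetoid I G)

/-- The point of `(ℂ^ι - V(I)) / G` with homogeneous coordinates `z`. -/
def quotientSpace.mk {ι : Type} {I : Ideal (MvPolynomial ι ℂ)} {G : Subgroup (ι → ℂˣ)}
    (z : ι → ℂ) (hz : z ∈ stableLocus I) : quotientSpace I G :=
  Quotient.mk (orbitSetoid I G) ⟨z, hz⟩

/-- The homomorphism `(ℂ^*)^r → (ℂ^*)^ι` of tori given by a weight matrix `A`:
`λ ↦ (∏ i, λ_i ^ A_{ij})_j`. -/
def weightHom {ι : Type} {r : ℕ} (A : Matrix (Fin r) ι ℤ) : (Fin r → ℂˣ) →* (ι → ℂˣ) where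
  toFun t j := ∏ i, t i ^ A i j
  map_one' := by ext; simp
  map_mul' s t := by
    funext j
    simp only [Pi.mul_apply, mul_zpow, Finset.prod_mul_distrib]

/-- A toric stack `[(ℂ^ι - V(I)) / (ℂ^*)^r]`, given by its Cox ring `ℂ[x_j : j ∈ ι]`, its
irrelevant ideal `I` and the matrix `A` of weights of the action
`λ · x_j = (∏ i, λ_i ^ A_{ij}) x_j`. -/
structure ToricStack (ι : Type) (r : ℕ) where
  irrelevantIdeal : Ideal (MvPolynomial ι ℂ)
  weights : Matrix (Fin r) ι ℤ

/-- The subgroup of `(ℂ^*)^ι` through which the torus `(ℂ^*)^r` of a toric stack acts. -/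
def ToricStack.group {ι : Type} {r : ℕ} (T : ToricStack ι r) : Subgroup (ι → ℂˣ) :=
  (weightHom T.weights).range

/-- The quotient variety `(ℂ^ι - V(I)) / (ℂ^*)^r`, the coarse moduli space of the toric stack. -/
abbrev ToricStack.variety {ι : Type} {r : ℕ} (T : ToricStack ι r) : SpaceWithFunctions :=
  quotientSpace T.irrelevantIdeal T.group

/-! ### Stacky fans, their Cox data, and star subdivisions -/

/-- A stacky fan in the lattice `ℤ^d`, given by vectors `ray i` on its rays and by the index sets
of its (simplicial) cones; the fan axioms are the predicate `StackyFan.IsFan`. -/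
structure StackyFan (d : ℕ) (ι : Type) where
  ray : ι → Fin d → ℤ
  cones : Set (Finset ι)

namespace StackyFan

variable {d : ℕ} {ι : Type} [Fintype ι] [DecidableEq ι]

/-- The vector on the `i`-th ray, in the real vector space spanned by the lattice. -/
def realRay (S : StackyFan d ι) (i : ι) : Fin d → ℝ := fun j => (S.ray i j : ℝ)

/-- The convex cone spanned by the rays with index in `σ`. -/
def cone (S : StackyFan d ι) (σ : Finset ι) : Set (Fin d → ℝ) :=
  {x | ∃ c : ι → ℝ, (∀ i, 0 ≤ c i) ∧ (∀ i, i ∉ σ → c i = 0) ∧ x = ∑ i, c i • S.realRay i}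

/-- The simplicial fan axioms, for fans whose rays span the ambient space. -/
structure IsFan (S : StackyFan d ι) : Prop where
  down_closed : ∀ σ ∈ S.cones, ∀ τ ⊆ σ, τ ∈ S.cones
  ray_mem : ∀ i, {i} ∈ S.cones
  linearIndepOn : ∀ σ ∈ S.cones, LinearIndepOn ℝ S.realRay (σ : Set ι)
  inter : ∀ σ ∈ S.cones, ∀ τ ∈ S.cones, S.cone σ ∩ S.cone τ = S.cone (σ ∩ τ)
  span : Submodule.span ℝ (Set.range S.realRay) = ⊤

/-- The irrelevant ideal in the Cox ring: it is generated by the products, for the cones `σ`, of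
the variables that do not belong to `σ`. -/
noncomputable def irrelevantIdeal (S : StackyFan d ι) : Ideal (MvPolynomial ι ℂ) :=
  Ideal.span {p | ∃ σ ∈ S.cones, p = ∏ i ∈ σᶜ, X i}

/-- The group of the quotient construction: all `t ∈ (ℂ^*)^ι` with
`∏ i, t_i ^ ⟨e_j, ray i⟩ = 1` for every `j`. -/
def coxGroup (S : StackyFan d ι) : Subgroup (ι → ℂˣ) where
  carrier := {t | ∀ j, ∏ i, t i ^ S.ray i j = 1}
  one_mem' := by simp
  mul_mem' := by
    intro s t hs ht j
    simp only [Pi.mul_apply, mul_zpow, Finset.prod_mul_distrib, hs j, ht j, mul_one]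
  inv_mem' := by
    intro s hs j
    simp only [Pi.inv_apply, inv_zpow, Finset.prod_inv_distrib, hs j, inv_one]

/-- The star subdivision at the lattice vector `γ`. The new ray has the index `none`. The cones
are the old cones that do not contain `γ`, and the cones spanned by `γ` and by a cone `τ` that does
not contain `γ` but is a face of a cone that contains `γ`. -/
def starSubdivision (S : StackyFan d ι) (γ : Fin d → ℤ) : StackyFan d (Option ι) where
  ray v := v.elim γ S.ray
  cones :=
    {ρ | ∃ σ ∈ S.cones, (fun j => (γ j : ℝ)) ∉ S.cone σ ∧
      ρ = σ.map Function.Embedding.some} ∪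
    {ρ | ∃ τ ∈ S.cones, (fun j => (γ j : ℝ)) ∉ S.cone τ ∧
      (∃ σ ∈ S.cones, τ ⊆ σ ∧ (fun j => (γ j : ℝ)) ∈ S.cone σ) ∧ ρ = Finset.insertNone τ}

end StackyFan

/-! ### Weighted blow ups of cyclic quotient singularities -/

/-- The group `μ_r` acting on `ℂ^δ` by `ε · z_i = ε ^ c_i z_i`. -/
def cyclicGroup {δ : Type} (r : ℕ) (c : δ → ℕ) : Subgroup (δ → ℂˣ) where
  carrier := {s | ∃ ε ∈ rootsOfUnity r ℂ, ∀ i, s i = ε ^ c i}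
  one_mem' := ⟨1, one_mem _, by simp⟩
  mul_mem' := by
    rintro s s' ⟨ε, hε, h⟩ ⟨ε', hε', h'⟩
    exact ⟨ε * ε', mul_mem hε hε', fun i => by simp [h, h', mul_pow]⟩
  inv_mem' := by
    rintro s ⟨ε, hε, h⟩
    exact ⟨ε⁻¹, inv_mem hε, fun i => by simp [h]⟩

/-- The cyclic quotient singularity `ℂ^δ / μ_r` of type `(1/r)(c_i)_i`. -/
noncomputable abbrev cyclicQuotient {δ : Type} (r : ℕ) (c : δ → ℕ) : SpaceWithFunctions :=
  quotientSpace (⊤ : Ideal (MvPolynomial δ ℂ)) (cyclicGroup r c)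

/-- Every point of `ℂ^δ` defines a point of `ℂ^δ / μ_r`. -/
noncomputable def cyclicQuotient.mk {δ : Type} {r : ℕ} {c : δ → ℕ} (z : δ → ℂ) : cyclicQuotient r c :=
  quotientSpace.mk z (by simp [stableLocus, zeroLocus_top])

/-- The group `ℂ^* × μ_r` acting on `ℂ^δ × ℂ`, whose last coordinate has the index `none`, by
`(t, ε) · (z_i, u) = (t ^ b_i ε ^ c_i z_i, t⁻¹ u)`. -/
def weightedBlowUpGroup {δ : Type} (r : ℕ) (c b : δ → ℕ) : Subgroup (Option δ → ℂˣ) where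
  carrier := {s | ∃ t : ℂˣ, ∃ ε ∈ rootsOfUnity r ℂ,
    (∀ i, s (some i) = t ^ b i * ε ^ c i) ∧ s none = t⁻¹}
  one_mem' := ⟨1, 1, one_mem _, by simp⟩
  mul_mem' := by
    rintro s s' ⟨t, ε, hε, h, h0⟩ ⟨t', ε', hε', h', h0'⟩
    refine ⟨t * t', ε * ε', mul_mem hε hε', fun i => ?_, ?_⟩
    · simp only [Pi.mul_apply, h, h', mul_pow]
      exact mul_mul_mul_comm _ _ _ _
    · simp only [Pi.mul_apply, h0, h0', mul_inv]
  inv_mem' := by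
    rintro s ⟨t, ε, hε, h, h0⟩
    exact ⟨t⁻¹, ε⁻¹, inv_mem hε, fun i => by simp [h, mul_comm], by simp [h0]⟩

/-- The weighted blow up of `ℂ^δ / μ_r` at the origin with weights `(1/r)(b_i)_i`. The weighted
blow up of `ℂ^δ` with weights `b` is `((ℂ^δ - 0) × ℂ) / ℂ^*` with its map
`(z_i, u) ↦ (u ^ b_i z_i)` to `ℂ^δ`, and `μ_r` acts on it by `ε · (z_i, u) = (ε ^ c_i z_i, u)`. The
weighted blow up of `ℂ^δ / μ_r` is the quotient by this action. -/
noncomputable abbrev weightedBlowUp {δ : Type} (r : ℕ) (c b : δ → ℕ) : SpaceWithFunctions :=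
  quotientSpace (Ideal.span (Set.range fun i : δ => (X (some i) : MvPolynomial (Option δ) ℂ)))
    (weightedBlowUpGroup r c b)

/-- `π : Y → X` is the weighted blow up of `X` at the point `p` with weights `(1/r)(b_i)_i` in the
orbifold coordinates that are given by the chart `φ : ℂ^δ / μ_r → X` centred at `p`. -/
structure IsWeightedBlowUp {Y X : SpaceWithFunctions} (π : Y → X) (p : X) {δ : Type} {r : ℕ}
    {c : δ → ℕ} (φ : cyclicQuotient r c → X) (b : δ → ℕ) : Prop where
  /-- The chart is an isomorphism onto an open neighbourhood of `p`, and maps `0` to `p`. -/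
  chart : IsOpenImmersionOn φ Set.univ
  chart_zero : φ (cyclicQuotient.mk 0) = p
  /-- The weights are positive, and `(1/r) b` lies in the lattice generated by `ℤ^δ` and
  `(1/r) c`. -/
  weight_pos : ∀ i, 0 < b i
  weight_mem : ∃ j : ℕ, ∀ i, b i ≡ j * c i [MOD r]
  /-- `π` is a morphism and an isomorphism over the complement of `p`. -/
  iso_off : IsOpenImmersionOn π (π ⁻¹' {p}ᶜ)
  surjective : Function.Surjective π
  /-- Over the chart, `π` is the weighted blow up of `ℂ^δ / μ_r`. -/
  model : ∃ ψ : weightedBlowUp r c b → Y, IsOpenImmersionOn ψ Set.univ ∧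
    Set.range ψ = π ⁻¹' Set.range φ ∧
    ∀ w hw, π (ψ (quotientSpace.mk w hw)) =
      φ (cyclicQuotient.mk fun i => w none ^ b i * w (some i))

/-! ### Weighted bundles over the projective line, and the rank 3 toric stack -/

/-- The variables `x_0, x_1` (left) and `y_0, …, y_m` (right). -/
abbrev BundleVar (m : ℕ) : Type := Fin 2 ⊕ Fin (m + 1)

/-- The variables `X_0, X_1, Y_0, …, Y_m` (as `some`) and `ξ` (as `none`). -/
abbrev BlowUpVar (m : ℕ) : Type := Option (BundleVar m)

/-- The weighted projective space `ℙ(a_0, …, a_m)` is well-formed. -/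
def WellFormed {m : ℕ} (a : Fin (m + 1) → ℕ) : Prop :=
  ∀ i, (Finset.univ.erase i).gcd a = 1

/-- The weighted bundle over `ℙ^1` with irrelevant ideal `(x_0, x_1) ∩ (y_0, …, y_m)` and weights
`(1, 1, -ω_0, …, -ω_m)` and `(0, 0, a_0, …, a_m)`. -/
noncomputable def weightedBundle {m : ℕ} (ω a : Fin (m + 1) → ℕ) :
    ToricStack (BundleVar m) 2 where
  irrelevantIdeal := Ideal.span {X (Sum.inl 0), X (Sum.inl 1)} ⊓
    Ideal.span (Set.range fun i => X (Sum.inr i))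
  weights := ![Sum.elim (fun _ => 1) (fun i => -(ω i : ℤ)), Sum.elim (fun _ => 0) (fun i => a i)]

/-- The entries `(b_k, 0, b_0, …, b_{k-1}, 0, b_{k+1}, …, b_m)`. -/
def blowUpWeight {m : ℕ} (k : Fin (m + 1)) (b : Fin (m + 1) → ℕ) : BundleVar m → ℕ :=
  Sum.elim ![b k, 0] (fun i => if i = k then 0 else b i)

/-- The rank 3 toric stack with Cox ring `ℂ[X_0, X_1, Y_0, …, Y_m, ξ]`. -/
noncomputable def rankThreeStack {m : ℕ} (ω a : Fin (m + 1) → ℕ) (k : Fin (m + 1))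
    (b : Fin (m + 1) → ℕ) : ToricStack (BlowUpVar m) 3 where
  irrelevantIdeal :=
    Ideal.span {X (some (Sum.inl 0)), X (some (Sum.inl 1))} ⊓
    Ideal.span (Set.range fun i => X (some (Sum.inr i))) ⊓
    Ideal.span {X none, X (some (Sum.inl 1))} ⊓
    Ideal.span {X none, X (some (Sum.inr k))} ⊓
    Ideal.span (insert (X (some (Sum.inl 0))) {p | ∃ i, i ≠ k ∧ p = X (some (Sum.inr i))})
  weights := ![fun v => v.elim 0 ((weightedBundle ω a).weights 0),
    fun v => v.elim 0 ((weightedBundle ω a).weights 1),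
    fun v => v.elim (-(a k : ℤ)) (fun v => (blowUpWeight k b v : ℤ))]

/-- The fan of the weighted bundle in `ℤ^{m+1}`, with standard basis `α_1, β_1, …, β_m` (in this
order), `β_0 = -∑_{i ≥ 1} a_i β_i` and `α_0 = -α_1 + ∑_{i ≥ 0} ω_i β_i`. The maximal cones are
spanned by all rays but one `α_s` and one `β_r`. -/
def bundleFan {m : ℕ} (ω a : Fin (m + 1) → ℕ) : StackyFan (m + 1) (BundleVar m) :=
  let α₁ : Fin (m + 1) → ℤ := Pi.single 0 1
  let β : Fin (m + 1) → Fin (m + 1) → ℤ := fun i =>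
    if i = 0 then -∑ j ∈ Finset.univ.erase 0, (a j : ℤ) • Pi.single j 1 else Pi.single i 1
  { ray := Sum.elim ![-α₁ + ∑ i, (ω i : ℤ) • β i, α₁] β
    cones := {σ | ∃ s r, Sum.inl s ∉ σ ∧ Sum.inr r ∉ σ} }

/-- The point `(0 : 1; 0 : ⋯ : 1 : ⋯ : 0)`, with `y_k = 1`, in homogeneous coordinates. -/
def basePoint {m : ℕ} (k : Fin (m + 1)) : BundleVar m → ℂ :=
  Sum.elim ![0, 1] (Pi.single k 1)

/-- The variables other than `x_1` and `y_k`, the local coordinates at the point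
`(0 : 1; 0 : ⋯ : 1 : ⋯ : 0)`. -/
abbrev ChartVar {m : ℕ} (k : Fin (m + 1)) : Type :=
  {v : BundleVar m // v ≠ Sum.inl 1 ∧ v ≠ Sum.inr k}

/-- The weights of the variables in the second row of the weight matrix: `μ_{a_k}` acts with these
weights on the local coordinates. -/
def chartType {m : ℕ} (a : Fin (m + 1) → ℕ) (k : Fin (m + 1)) : ChartVar k → ℕ :=
  fun v => Sum.elim (fun _ => 0) a v.1

/-- The homogeneous coordinates with `x_1 = y_k = 1` and the other coordinates given by `z`. -/
def chartPoint {m : ℕ} {k : Fin (m + 1)} (z : ChartVar k → ℂ) : BundleVar m → ℂ :=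
  fun v => if h : v ≠ Sum.inl 1 ∧ v ≠ Sum.inr k then z ⟨v, h⟩ else 1

end ToricBlowUp

/-!
Points of all the spaces are classes of homogeneous coordinates modulo a group of diagonal matrices.

The linear relations among the rays of the bundle are the two rows of its weight matrix, which
forces a vector to lie in the relative interior of at most one cone. Since `a_k γ` has the weights
`b` as coordinates in the cone of `p`, subdividing at `γ` only adds the coordinate `ξ`, and the
relation that defines `γ` is the third row of the weight matrix. Its entry `-a_k` and the
congruences `b_i ≡ a_i` make `μ_{a_k}` the generic stabiliser.

A regular function is locally a quotient of two semi-invariant polynomials of the same weight. The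
rule for `π` is not polynomial because of `ξ^{1/a_k}`, but two monomials of the same weight have
exponents that are congruent modulo `a_k` after substitution, so that the root occurs only in a
factor common to all the monomials involved, which cancels in the quotient. The same argument shows
that the inverse of `π` away from `p`, and the inverses of the charts `x_1 = y_k = 1`, which require
roots of `y_k`, are morphisms.
-/

namespace ToricBlowUp

/-! ### Semi-invariant polynomials and regular functions on quotients -/

section Zariski

variable {ι : Type} {Z : Set (ι → ℂ)}

theorem isTopologicalBasis_zariskiSpace (Z : Set (ι → ℂ)) :
    TopologicalSpace.IsTopologicalBasis
      (Set.range fun P : MvPolynomial ι ℂ => {z : zariskiSpace Z | eval z.1 P ≠ 0}) where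
  exists_subset_inter := by
    rintro _ ⟨P, rfl⟩ _ ⟨Q, rfl⟩ z ⟨hP, hQ⟩
    refine ⟨_, ⟨P * Q, rfl⟩, by simpa using ⟨hP, hQ⟩, fun w hw => ?_⟩
    simpa [not_or] using hw
  sUnion_eq := Set.eq_univ_of_forall fun z => ⟨_, ⟨1, rfl⟩, by simp⟩
  eq_generateFrom := rfl

theorem isOpen_zariskiSpace_iff {V : Set (zariskiSpace Z)} :
    IsOpen V ↔ ∀ z ∈ V, ∃ P : MvPolynomial ι ℂ, eval z.1 P ≠ 0 ∧
      ∀ w : zariskiSpace Z, eval w.1 P ≠ 0 → w ∈ V := by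
  simp [(isTopologicalBasis_zariskiSpace Z).isOpen_iff, Set.subset_def]

end Zariski

section HomogeneousPolynomials

variable {ι : Type}

/-- The character by which a group of diagonal matrices acts on the `i`-th coordinate, as an
element of the additive group of characters. Polynomials that are weighted homogeneous for these
weights are the semi-invariants. -/
noncomputable def coordChar (G : Subgroup (ι → ℂˣ)) (i : ι) : Additive (G →* ℂ) :=
  .ofMul ((Units.coeHom ℂ).comp ((Pi.evalMonoidHom _ i).comp G.subtype))

variable {G : Subgroup (ι → ℂˣ)} {P : MvPolynomial ι ℂ} {χ : Additive (G →* ℂ)} {z : ι → ℂ}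

theorem weight_coordChar_apply (d : ι →₀ ℕ) (t : G) :
    (Finsupp.weight (coordChar G) d).toMul t = ∏ i ∈ d.support, (t.1 i : ℂ) ^ d i := by
  rw [Finsupp.weight_apply, Finsupp.sum, toMul_sum, MonoidHom.finsetProd_apply]
  rfl

theorem eval_smul_of_isWeightedHomogeneous
    (hP : IsWeightedHomogeneous (coordChar G) P χ) (t : G) (z : ι → ℂ) :
    eval (t.1 • z) P = χ.toMul t * eval z P := by
  rw [eval_eq, eval_eq, Finset.mul_sum]
  refine Finset.sum_congr rfl fun d hd => ?_
  rw [← hP (mem_support_iff.1 hd), weight_coordChar_apply]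
  simp only [Pi.smul_apply', Units.smul_def, smul_eq_mul, mul_pow, Finset.prod_mul_distrib]
  ring

theorem eval_eq_sum_weightedHomogeneousComponent (P : MvPolynomial ι ℂ) :
    ∃ s : Finset (Additive (G →* ℂ)),
      (∀ χ ∉ s, weightedHomogeneousComponent (coordChar G) χ P = 0) ∧
      ∀ z, eval z P = ∑ χ ∈ s, eval z (weightedHomogeneousComponent (coordChar G) χ P) := by
  have hfin := weightedHomogeneousComponent_finsupp (w := coordChar G) P
  refine ⟨hfin.toFinset, fun χ hχ => not_not.1 fun h => hχ (hfin.mem_toFinset.2 h), fun z => ?_⟩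
  rw [← map_sum, ← finsum_eq_sum _ hfin, sum_weightedHomogeneousComponent]

theorem eval_weightedHomogeneousComponent_eq_zero
    (h : ∀ t : G, eval (t.1 • z) P = 0) (χ : Additive (G →* ℂ)) :
    eval z (weightedHomogeneousComponent (coordChar G) χ P) = 0 := by
  obtain ⟨s, hs, hsum⟩ := eval_eq_sum_weightedHomogeneousComponent (G := G) P
  by_cases hχ : χ ∈ s
  · have independent := (linearIndependent_monoidHom G ℂ).comp Additive.toMul
      Additive.toMul.injective
    refine linearIndependent_iff'.1 independent s
      (fun ψ => eval z (weightedHomogeneousComponent (coordChar G) ψ P)) (funext fun t => ?_) χ hχ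
    rw [Finset.sum_apply, Pi.zero_apply, ← h t, hsum]
    refine Finset.sum_congr rfl fun ψ _ => ?_
    rw [eval_smul_of_isWeightedHomogeneous (weightedHomogeneousComponent_isWeightedHomogeneous ψ P),
      mul_comm]
    rfl
  · rw [hs χ hχ, map_zero]

end HomogeneousPolynomials

section Quotient

variable {ι : Type} {I : Ideal (MvPolynomial ι ℂ)} {G : Subgroup (ι → ℂˣ)}

theorem mem_stableLocus_inf {J : Ideal (MvPolynomial ι ℂ)} {z : ι → ℂ} :
    z ∈ stableLocus (I ⊓ J) ↔ z ∈ stableLocus I ∧ z ∈ stableLocus J := by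
  simp only [stableLocus, Set.mem_compl_iff, mem_zeroLocus_iff, not_forall]
  constructor
  · rintro ⟨p, ⟨hpI, hpJ⟩, hp⟩
    exact ⟨⟨p, hpI, hp⟩, p, hpJ, hp⟩
  · rintro ⟨⟨p, hpI, hp⟩, q, hqJ, hq⟩
    exact ⟨p * q, ⟨I.mul_mem_right q hpI, J.mul_mem_left p hqJ⟩, by
      rw [map_mul]
      exact mul_ne_zero hp hq⟩

theorem mem_stableLocus_span {s : Set (MvPolynomial ι ℂ)} {z : ι → ℂ} :
    z ∈ stableLocus (Ideal.span s) ↔ ∃ p ∈ s, eval z p ≠ 0 := by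
  simp [stableLocus, zeroLocus_span, aeval_eq_eval]

namespace quotientSpace

theorem mk_eq_mk {z w : ι → ℂ} {hz : z ∈ stableLocus I} {hw : w ∈ stableLocus I} :
    (mk z hz : quotientSpace I G) = mk w hw ↔ ∃ t ∈ G, w = t • z :=
  Quotient.eq.trans (by simp only [funext_iff]; rfl)

theorem ind {p : quotientSpace I G → Prop} (h : ∀ z hz, p (mk z hz)) (x : quotientSpace I G) :
    p x :=
  Quotient.inductionOn x fun z => h z.1 z.2

theorem isOpen_iff {V : Set (quotientSpace I G)} :
    IsOpen V ↔ ∀ z hz, mk z hz ∈ V → ∃ P : MvPolynomial ι ℂ, eval z P ≠ 0 ∧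
      ∀ w hw, eval w P ≠ 0 → mk w hw ∈ V := by
  change IsOpen (Quotient.mk _ ⁻¹' V : Set (zariskiSpace (stableLocus I))) ↔ _
  simp only [isOpen_zariskiSpace_iff]
  exact ⟨fun h z hz hzV => (h ⟨z, hz⟩ hzV).imp fun P hP => ⟨hP.1, fun w hw => hP.2 ⟨w, hw⟩⟩,
    fun h z hzV => (h z.1 z.2 hzV).imp fun P hP => ⟨hP.1, fun w => hP.2 w.1 w.2⟩⟩

variable {U : Set (quotientSpace I G)} {f : quotientSpace I G → ℂ}

theorem mem_reg (hU : IsOpen U)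
    (h : ∀ z hz, mk z hz ∈ U → ∃ P Q : MvPolynomial ι ℂ, eval z Q ≠ 0 ∧
      ∀ w hw, eval w Q ≠ 0 → f (mk w hw) = eval w P / eval w Q) :
    f ∈ (quotientSpace I G).reg U := by
  intro z hz
  obtain ⟨P, Q, hQ, hPQ⟩ := h z.1 z.2 hz
  exact ⟨_, (hU.preimage continuous_quotient_mk').inter
    ((isTopologicalBasis_zariskiSpace _).isOpen ⟨Q, rfl⟩), ⟨hz, hQ⟩,
    Set.inter_subset_left, P, Q, fun w hw => ⟨hw.2, hPQ w.1 w.2 hw.2⟩⟩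

theorem exists_mul_eval_eq_of_mem_reg (hf : f ∈ (quotientSpace I G).reg U)
    {z : ι → ℂ} (hz : z ∈ stableLocus I) (hzU : mk z hz ∈ U) :
    ∃ P Q : MvPolynomial ι ℂ, eval z Q ≠ 0 ∧
      ∀ w hw, f (mk w hw) * eval w Q = eval w P ∧ (eval w Q ≠ 0 → mk w hw ∈ U) := by
  obtain ⟨V, hV, hzV, hVU, P, Q, h⟩ := hf ⟨z, hz⟩ hzU
  obtain ⟨R, hR, hRV⟩ := isOpen_zariskiSpace_iff.1 hV _ hzV
  refine ⟨R * P, R * Q, by simpa using ⟨hR, (h _ hzV).1⟩, fun w hw => ?_⟩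
  by_cases hRw : eval w R = 0
  · simp [hRw]
  · obtain ⟨hQw, hfw⟩ := h _ (hRV ⟨w, hw⟩ hRw)
    replace hfw : f (mk w hw) * eval w Q = eval w P := (eq_div_iff hQw).1 hfw
    refine ⟨?_, fun _ => hVU (hRV ⟨w, hw⟩ hRw)⟩
    rw [map_mul, map_mul, ← hfw, mul_left_comm]

end quotientSpace

/-- The set `ℂ^ι - V(I)` is stable under the torus of all diagonal matrices. -/
def IsTorusInvariant (I : Ideal (MvPolynomial ι ℂ)) : Prop :=
  ∀ z ∈ stableLocus I, ∀ t : ι → ℂˣ, t • z ∈ stableLocus I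

theorem quotientSpace.exists_isWeightedHomogeneous_of_mem_reg (hI : IsTorusInvariant I)
    {U : Set (quotientSpace I G)} {f : quotientSpace I G → ℂ}
    (hf : f ∈ (quotientSpace I G).reg U) {w : ι → ℂ} (hw : w ∈ stableLocus I) (hwU : mk w hw ∈ U) :
    ∃ χ P Q, IsWeightedHomogeneous (coordChar G) P χ ∧ IsWeightedHomogeneous (coordChar G) Q χ ∧
      eval w Q ≠ 0 ∧
      ∀ z hz, eval z Q ≠ 0 → mk z hz ∈ U ∧ f (mk z hz) = eval z P / eval z Q := by
  obtain ⟨P, Q, hQw, hPQ⟩ := exists_mul_eval_eq_of_mem_reg hf hw hwU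
  obtain ⟨χ, hχ⟩ : ∃ χ, eval w (weightedHomogeneousComponent (coordChar G) χ Q) ≠ 0 := by
    by_contra! h
    obtain ⟨s, -, hs⟩ := eval_eq_sum_weightedHomogeneousComponent (G := G) Q
    exact hQw ((hs w).trans (Finset.sum_eq_zero fun χ _ => h χ))
  have mk_smul (z hz) (t : G) : (mk z hz : quotientSpace I G) = mk (t.1 • z) (hI z hz t) :=
    mk_eq_mk.2 ⟨t, t.2, rfl⟩
  refine ⟨χ, _, _, weightedHomogeneousComponent_isWeightedHomogeneous χ P,
    weightedHomogeneousComponent_isWeightedHomogeneous χ Q, hχ, fun z hz hne => ⟨?_, ?_⟩⟩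
  · obtain ⟨t, ht⟩ : ∃ t : G, eval (t.1 • z) Q ≠ 0 := by
      by_contra! h
      exact hne (eval_weightedHomogeneousComponent_eq_zero h χ)
    exact (mk_smul z hz t).symm ▸ (hPQ _ (hI z hz t)).2 ht
  · have vanishes : ∀ t : G, eval (t.1 • z) (f (mk z hz) • Q - P) = 0 := fun t => by
      rw [map_sub, smul_eval, mk_smul z hz t, (hPQ _ (hI z hz t)).1, sub_self]
    have := eval_weightedHomogeneousComponent_eq_zero vanishes χ
    rwa [map_sub, map_smul, map_sub, smul_eval, sub_eq_zero, ← eq_div_iff hne] at this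

end Quotient

/-! ### Locally polynomial relations and morphisms -/

section Morphisms

variable {ι ι' : Type} [Fintype ι] {I : Ideal (MvPolynomial ι ℂ)} {G : Subgroup (ι → ℂˣ)}
  {I' : Ideal (MvPolynomial ι' ℂ)} {G' : Subgroup (ι' → ℂˣ)}

/-- The group `G` acts with the same weight on all the monomials with exponent vectors in `S`. -/
def SameWeight (G : Subgroup (ι → ℂˣ)) (S : Finset (ι →₀ ℕ)) : Prop :=
  ∀ d ∈ S, ∀ d' ∈ S, ∀ t ∈ G, ∏ i, t i ^ d i = ∏ i, t i ^ d' i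

/-- The relation `r` between two quotients is locally polynomial if monomials of the same weight
in the coordinates of the second one become, locally along `r` and up to a common factor,
polynomials in the coordinates of the first one. -/
def IsLocallyPolynomial (r : quotientSpace I' G' → quotientSpace I G → Prop) : Prop :=
  ∀ S, SameWeight G S → ∀ w hw w' hw', r (quotientSpace.mk w' hw') (quotientSpace.mk w hw) →
    (∃ d ∈ S, ∏ i, w i ^ d i ≠ 0) →
    ∃ (N : MvPolynomial ι' ℂ) (E : (ι →₀ ℕ) → MvPolynomial ι' ℂ), eval w' N ≠ 0 ∧
      ∀ z' hz', eval z' N ≠ 0 → ∃ z hz, r (quotientSpace.mk z' hz') (quotientSpace.mk z hz) ∧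
        ∃ μ : ℂ, μ ≠ 0 ∧ ∀ d ∈ S, ∏ i, z i ^ d i = μ * eval z' (E d)

theorem sameWeight_support_union [DecidableEq ι] {χ : Additive (G →* ℂ)} {P Q : MvPolynomial ι ℂ}
    (hP : IsWeightedHomogeneous (coordChar G) P χ) (hQ : IsWeightedHomogeneous (coordChar G) Q χ) :
    SameWeight G (P.support ∪ Q.support) := by
  have weight_eq : ∀ d ∈ P.support ∪ Q.support, Finsupp.weight (coordChar G) d = χ := fun d hd =>
    (Finset.mem_union.1 hd).elim (fun h => hP (mem_support_iff.1 h))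
      fun h => hQ (mem_support_iff.1 h)
  intro d hd d' hd' t ht
  have := weight_coordChar_apply d ⟨t, ht⟩
  rw [weight_eq d hd, ← weight_eq d' hd', weight_coordChar_apply] at this
  simp only [← Units.val_pow_eq_pow_val, ← Units.coe_prod, Units.val_inj] at this
  rwa [← Finsupp.prod, ← Finsupp.prod, Finsupp.prod_fintype _ _ (by simp),
    Finsupp.prod_fintype _ _ (by simp), eq_comm] at this

theorem eval_eq_mul_eval_sum {F : MvPolynomial ι ℂ} {S : Finset (ι →₀ ℕ)} (hF : F.support ⊆ S)
    {E : (ι →₀ ℕ) → MvPolynomial ι' ℂ} {z : ι → ℂ} {z' : ι' → ℂ} {μ : ℂ}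
    (h : ∀ d ∈ S, ∏ i, z i ^ d i = μ * eval z' (E d)) :
    eval z F = μ * eval z' (∑ d ∈ F.support, C (F.coeff d) * E d) := by
  rw [eval_eq', map_sum, Finset.mul_sum]
  exact Finset.sum_congr rfl fun d hd => by rw [h d (hF hd), map_mul, eval_C, mul_left_comm]

namespace IsLocallyPolynomial

variable {r : quotientSpace I' G' → quotientSpace I G → Prop} {U : Set (quotientSpace I G)}
  {f : quotientSpace I G → ℂ}

theorem exists_fraction (hr : IsLocallyPolynomial r) (hI : IsTorusInvariant I)
    (unique : ∀ y x x', r y x → r y x' → x = x') (hf : f ∈ (quotientSpace I G).reg U)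
    {w' : ι' → ℂ} {hw' : w' ∈ stableLocus I'} {x : quotientSpace I G}
    (hx : r (quotientSpace.mk w' hw') x) (hxU : x ∈ U) :
    ∃ P Q : MvPolynomial ι' ℂ, eval w' Q ≠ 0 ∧ ∀ z' hz', eval z' Q ≠ 0 →
      ∃ x ∈ U, r (quotientSpace.mk z' hz') x ∧ f x = eval z' P / eval z' Q := by
  classical
  induction x using quotientSpace.ind with | h w hw
  obtain ⟨χ, P, Q, hP, hQ, hQw, hPQ⟩ :=
    quotientSpace.exists_isWeightedHomogeneous_of_mem_reg hI hf hw hxU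
  obtain ⟨d₀, hd₀, hd₀w⟩ : ∃ d ∈ P.support ∪ Q.support, ∏ i, w i ^ d i ≠ 0 := by
    rw [eval_eq'] at hQw
    obtain ⟨d, hd, h⟩ := Finset.exists_ne_zero_of_sum_ne_zero hQw
    exact ⟨d, Finset.mem_union_right _ hd, right_ne_zero_of_mul h⟩
  obtain ⟨N, E, hN, hE⟩ := hr _ (sameWeight_support_union hP hQ) w hw w' hw' hx ⟨d₀, hd₀, hd₀w⟩
  refine ⟨N * ∑ d ∈ P.support, C (P.coeff d) * E d, N * ∑ d ∈ Q.support, C (Q.coeff d) * E d, ?_,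
    fun z' hz' hne => ?_⟩
  · obtain ⟨z, hz, hzw, μ, -, hμ⟩ := hE w' hw' hN
    obtain ⟨t, ht, rfl⟩ := quotientSpace.mk_eq_mk.1 (unique _ _ _ hx hzw)
    have : eval (t • w) Q ≠ 0 := by
      rw [eval_smul_of_isWeightedHomogeneous hQ ⟨t, ht⟩]
      exact mul_ne_zero (Group.isUnit _ |>.map χ.toMul).ne_zero hQw
    rw [eval_eq_mul_eval_sum Finset.subset_union_right hμ] at this
    simpa [hN] using right_ne_zero_of_mul this
  · rw [map_mul] at hne
    obtain ⟨z, hz, hzw, μ, hμ₀, hμ⟩ := hE z' hz' (left_ne_zero_of_mul hne)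
    have hQz := eval_eq_mul_eval_sum Finset.subset_union_right hμ
    obtain ⟨hzU, hfz⟩ := hPQ z hz (hQz ▸ mul_ne_zero hμ₀ (right_ne_zero_of_mul hne))
    refine ⟨_, hzU, hzw, ?_⟩
    rw [hfz, hQz, eval_eq_mul_eval_sum Finset.subset_union_left hμ, map_mul, map_mul,
      mul_div_mul_left _ _ hμ₀, mul_div_mul_left _ _ (left_ne_zero_of_mul hne)]

theorem isOpen (hr : IsLocallyPolynomial r) (hI : IsTorusInvariant I)
    (unique : ∀ y x x', r y x → r y x' → x = x') (hU : IsOpen U) :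
    IsOpen {y | ∃ x ∈ U, r y x} := by
  refine quotientSpace.isOpen_iff.2 fun w' hw' ⟨x, hxU, hx⟩ => ?_
  obtain ⟨P, Q, hQ, hPQ⟩ :=
    hr.exists_fraction hI unique ((quotientSpace I G).const_mem U hU 0) hx hxU
  exact ⟨Q, hQ, fun z' hz' hne => let ⟨x, hxU, hx, _⟩ := hPQ z' hz' hne; ⟨x, hxU, hx⟩⟩

theorem mem_reg (hr : IsLocallyPolynomial r) (hI : IsTorusInvariant I)
    (unique : ∀ y x x', r y x → r y x' → x = x') (hU : IsOpen U)
    (hf : f ∈ (quotientSpace I G).reg U) {g : quotientSpace I' G' → ℂ}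
    (hg : ∀ y, ∀ x ∈ U, r y x → g y = f x) :
    g ∈ (quotientSpace I' G').reg {y | ∃ x ∈ U, r y x} := by
  refine quotientSpace.mem_reg (hr.isOpen hI unique hU) fun w' hw' ⟨x, hxU, hx⟩ => ?_
  obtain ⟨P, Q, hQ, hPQ⟩ := hr.exists_fraction hI unique hf hx hxU
  refine ⟨P, Q, hQ, fun z' hz' hne => ?_⟩
  obtain ⟨x, hxU, hx, hfx⟩ := hPQ z' hz' hne
  rw [hg _ x hxU hx, hfx]

end IsLocallyPolynomial

theorem isMorphism_of_isLocallyPolynomial {f : quotientSpace I' G' → quotientSpace I G}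
    (hI : IsTorusInvariant I) (hf : IsLocallyPolynomial fun y x => f y = x) : IsMorphism f := by
  have unique : ∀ y x x', f y = x → f y = x' → x = x' := fun _ _ _ h h' => h.symm.trans h'
  have preimage_eq (V : Set (quotientSpace I G)) : f ⁻¹' V = {y | ∃ x ∈ V, f y = x} := by
    simp [Set.preimage]
  refine ⟨continuous_def.2 fun V hV => preimage_eq V ▸ hf.isOpen hI unique hV, fun V hV g hg => ?_⟩
  exact preimage_eq V ▸ hf.mem_reg hI unique hV hg fun _ _ _ h => congrArg g h

theorem isOpenImmersionOn_of_isLocallyPolynomial {f : quotientSpace I G → quotientSpace I' G'}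
    {W : Set (quotientSpace I G)} (hI : IsTorusInvariant I) (hf : IsMorphism f) (hW : IsOpen W)
    (hinj : Set.InjOn f W) (h : IsLocallyPolynomial fun y x => x ∈ W ∧ f x = y) :
    IsOpenImmersionOn f W := by
  classical
  have unique : ∀ y x x', (x ∈ W ∧ f x = y) → (x' ∈ W ∧ f x' = y) → x = x' :=
    fun _ _ _ hx hx' => hinj hx.1 hx'.1 (hx.2.trans hx'.2.symm)
  refine ⟨hf, hW, hinj, fun V hV hVW => ?_⟩
  have image_eq : f '' V = {y | ∃ x ∈ V, x ∈ W ∧ f x = y} := by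
    ext y
    exact exists_congr fun x => and_congr_right fun hx => (and_iff_right (hVW hx)).symm
  rw [image_eq]
  refine ⟨h.isOpen hI unique hV, fun g hg => ?_⟩
  let inv (y : quotientSpace I' G') : ℂ := if hy : ∃ x, x ∈ W ∧ f x = y then g hy.choose else 0
  have inv_eq : ∀ y x, (x ∈ W ∧ f x = y) → inv y = g x := fun y x hx => by
    have hy : ∃ x, x ∈ W ∧ f x = y := ⟨x, hx⟩
    simp only [inv, dif_pos hy, unique y _ _ hy.choose_spec hx]
  exact ⟨inv, h.mem_reg hI unique hV hg fun y x _ hx => inv_eq y x hx,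
    fun x hx => inv_eq _ x ⟨hVW hx, rfl⟩⟩

omit [Fintype ι] in
theorem isMorphism_of_polynomial [Finite ι] {f : quotientSpace I' G' → quotientSpace I G}
    (hI : IsTorusInvariant I) (s : ι → MvPolynomial ι' ℂ)
    (h : ∀ z hz, ∃ hz', f (quotientSpace.mk z hz) = quotientSpace.mk (fun i => eval z (s i)) hz') :
    IsMorphism f := by
  cases nonempty_fintype ι
  refine isMorphism_of_isLocallyPolynomial hI fun S _ _ _ _ _ _ _ =>
    ⟨1, fun d => ∏ i, s i ^ d i, by simp, fun z hz _ => ?_⟩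
  obtain ⟨hz', e⟩ := h z hz
  exact ⟨_, hz', e, 1, one_ne_zero, fun d _ => by simp⟩

end Morphisms

/-! ### Cones and star subdivisions -/

namespace StackyFan

variable {d : ℕ} {ι : Type} [Fintype ι]

/-- The coefficient vectors of the points of the cone with index set `σ`. -/
def coneCoords (σ : Finset ι) : Set (ι → ℝ) := {c | (∀ i, 0 ≤ c i) ∧ ∀ i ∉ σ, c i = 0}

omit [Fintype ι] in
theorem coneCoords_mono {σ τ : Finset ι} (h : σ ⊆ τ) : coneCoords σ ⊆ coneCoords τ :=
  fun _ hc => ⟨hc.1, fun i hi => hc.2 i fun hi' => hi (h hi')⟩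

theorem cone_eq_image (S : StackyFan d ι) (σ : Finset ι) :
    S.cone σ = (fun c => ∑ i, c i • S.realRay i) '' coneCoords σ := by
  ext x
  simp [cone, coneCoords, and_assoc, eq_comm]

theorem linearIndepOn_iff_injOn (S : StackyFan d ι) (σ : Finset ι) :
    LinearIndepOn ℝ S.realRay (σ : Set ι) ↔
      Set.InjOn (fun c => ∑ i, c i • S.realRay i) (coneCoords σ) := by
  classical
  rw [linearIndepOn_finset_iff]
  constructor
  · intro h c hc e he hce
    have hsum : ∑ i ∈ σ, (c i - e i) • S.realRay i = 0 := by
      rw [Finset.sum_subset (Finset.subset_univ σ) fun i _ hi => by simp [hc.2 i hi, he.2 i hi]]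
      simpa [sub_smul, sub_eq_zero] using hce
    funext i
    by_cases hi : i ∈ σ
    · exact sub_eq_zero.1 (h _ hsum i hi)
    · rw [hc.2 i hi, he.2 i hi]
  · intro h f hf i hi
    set g : ι → ℝ := fun i => if i ∈ σ then f i else 0 with hg
    have hg_notMem : ∀ i ∉ σ, g i = 0 := fun i hi => if_neg hi
    have hsum : ∑ i, g i • S.realRay i = 0 := by simpa [hg, ite_smul] using hf
    have posPart_eq_negPart : g⁺ = g⁻ := by
      refine h ⟨fun i => posPart_nonneg (g i), fun i hi => ?_⟩
        ⟨fun i => negPart_nonneg (g i), fun i hi => ?_⟩ (sub_eq_zero.1 ?_)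
      · rw [hg_notMem i hi, posPart_zero]
      · change (g i)⁻ = 0
        rw [hg_notMem i hi, negPart_zero]
      · rw [← Finset.sum_sub_distrib, ← hsum]
        refine Finset.sum_congr rfl fun i _ => ?_
        rw [← sub_smul]
        exact congrArg (· • S.realRay i) (posPart_sub_negPart (g i))
    have : g = 0 := by rw [← posPart_sub_negPart g, posPart_eq_negPart, sub_self]
    simpa [hg, hi] using congrFun this i

variable [DecidableEq ι] {S : StackyFan d ι}

theorem isFan_of_injOn (lower : IsLowerSet S.cones) (ray_mem : ∀ i, {i} ∈ S.cones)
    (span : Submodule.span ℝ (Set.range S.realRay) = ⊤)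
    (injOn : Set.InjOn (fun c => ∑ i, c i • S.realRay i) (⋃ σ ∈ S.cones, coneCoords σ)) :
    S.IsFan where
  down_closed _ hσ _ hτ := lower hτ hσ
  ray_mem := ray_mem
  span := span
  linearIndepOn σ hσ := (S.linearIndepOn_iff_injOn σ).2 (injOn.mono (Set.subset_biUnion_of_mem hσ))
  inter σ hσ τ hτ := by
    simp only [cone_eq_image]
    rw [← injOn.image_inter (Set.subset_biUnion_of_mem hσ) (Set.subset_biUnion_of_mem hτ)]
    congr 1
    ext c
    simp only [coneCoords, Set.mem_inter_iff, Set.mem_ofPred_eq, Finset.mem_inter]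
    grind

namespace IsFan

theorem isLowerSet (hS : S.IsFan) : IsLowerSet S.cones := fun σ τ hτ hσ => hS.down_closed σ hσ τ hτ

theorem injOn (hS : S.IsFan) :
    Set.InjOn (fun c => ∑ i, c i • S.realRay i) (⋃ σ ∈ S.cones, coneCoords σ) := by
  simp only [Set.InjOn, Set.mem_iUnion₂]
  rintro c ⟨σ, hσ, hc⟩ e ⟨τ, hτ, he⟩ hce
  have hmem : ∑ i, c i • S.realRay i ∈ S.cone (σ ∩ τ) := by
    rw [← hS.inter σ hσ τ hτ, cone_eq_image, cone_eq_image]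
    exact ⟨⟨c, hc, rfl⟩, e, he, hce.symm⟩
  rw [cone_eq_image] at hmem
  obtain ⟨g, hg, hgc⟩ := hmem
  rw [← (S.linearIndepOn_iff_injOn σ).1 (hS.linearIndepOn σ hσ)
      (coneCoords_mono Finset.inter_subset_left hg) hc hgc,
    ← (S.linearIndepOn_iff_injOn τ).1 (hS.linearIndepOn τ hτ)
      (coneCoords_mono Finset.inter_subset_right hg) he (hgc.trans hce)]

end IsFan

theorem mem_irrelevantIdeal_iff (hS : IsLowerSet S.cones) {p : MvPolynomial ι ℂ} :
    p ∈ S.irrelevantIdeal ↔ ∀ n ∈ p.support, n.supportᶜ ∈ S.cones := by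
  have generators : {p : MvPolynomial ι ℂ | ∃ σ ∈ S.cones, p = ∏ i ∈ σᶜ, X i} =
      (fun s => monomial s (1 : ℂ)) ''
        ((fun σ : Finset ι => ∑ i ∈ σᶜ, Finsupp.single i 1) '' S.cones) := by
    ext p
    simp [Set.mem_image, monomial_sum_one, X, eq_comm]
  rw [irrelevantIdeal, generators, mem_ideal_span_monomial_image]
  refine forall₂_congr fun n _ => ?_
  have le_iff (σ : Finset ι) : ∑ i ∈ σᶜ, Finsupp.single i 1 ≤ n ↔ n.supportᶜ ⊆ σ := by
    rw [Finsupp.le_def, ← Finset.compl_subset_compl, compl_compl]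
    refine forall_congr' fun i => ?_
    by_cases hi : i ∈ σ <;>
      simp [Finsupp.finsetSum_apply, Finsupp.single_apply, hi, Nat.one_le_iff_ne_zero]
  simp only [Set.exists_mem_image, le_iff]
  exact ⟨fun ⟨σ, hσ, h⟩ => hS h hσ, fun h => ⟨_, h, subset_rfl⟩⟩

end StackyFan

theorem exists_units_pow_eq {n : ℕ} (hn : 0 < n) (x : ℂˣ) : ∃ u : ℂˣ, u ^ n = x := by
  obtain ⟨y, hy⟩ := IsAlgClosed.exists_pow_nat_eq (x : ℂ) hn
  have hy0 : y ≠ 0 := fun h => x.ne_zero (by rw [← hy, h, zero_pow hn.ne'])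
  exact ⟨Units.mk0 y hy0, Units.ext hy⟩

namespace StackyFan

variable {d : ℕ} {ι : Type} [Fintype ι]

/-- The vector `γ` lies in the relative interior of the cone `σ₀` of `S`, with coordinates `w / n`
with respect to the rays. -/
structure IsInteriorVector (S : StackyFan d ι) (σ₀ : Finset ι) (γ : Fin d → ℤ) (n : ℕ)
    (w : ι → ℕ) : Prop where
  pos : 0 < n
  smul_eq : (n : ℤ) • γ = ∑ v, (w v : ℤ) • S.ray v
  mem_cones : σ₀ ∈ S.cones
  mem_iff : ∀ v, v ∈ σ₀ ↔ w v ≠ 0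

namespace IsInteriorVector

variable {S : StackyFan d ι} {σ₀ : Finset ι} {γ : Fin d → ℤ} {n : ℕ} {w : ι → ℕ}

theorem smul_eq_real (h : S.IsInteriorVector σ₀ γ n w) :
    (n : ℝ) • (fun j => (γ j : ℝ)) = ∑ v, (w v : ℝ) • S.realRay v := by
  funext j
  simpa [realRay] using congrArg (Int.cast : ℤ → ℝ) (congrFun h.smul_eq j)

theorem sum_smul_starSubdivision (h : S.IsInteriorVector σ₀ γ n w) (c : Option ι → ℝ) :
    (n : ℝ) • ∑ v, c v • (S.starSubdivision γ).realRay v =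
      ∑ v, (n * c (some v) + w v * c none) • S.realRay v := by
  have hnone : (S.starSubdivision γ).realRay none = fun j => (γ j : ℝ) := rfl
  have hsome (v : ι) : (S.starSubdivision γ).realRay (some v) = S.realRay v := rfl
  simp only [Fintype.sum_option, hnone, hsome, smul_add, smul_comm (n : ℝ) (c none),
    h.smul_eq_real, Finset.smul_sum, add_smul, Finset.sum_add_distrib, mul_smul]
  rw [add_comm]
  simp only [smul_comm (c none)]

variable [DecidableEq ι]

theorem mem_cone_iff (h : S.IsInteriorVector σ₀ γ n w) (hS : S.IsFan) {σ : Finset ι}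
    (hσ : σ ∈ S.cones) : (fun j => (γ j : ℝ)) ∈ S.cone σ ↔ σ₀ ⊆ σ := by
  have hn : (n : ℝ) ≠ 0 := by exact_mod_cast h.pos.ne'
  have coords_mem : (fun v => (w v : ℝ) / n) ∈ coneCoords σ₀ :=
    ⟨fun v => by positivity, fun v hv => by simp [not_not.1 (mt (h.mem_iff v).2 hv)]⟩
  have sum_coords : ∑ v, ((w v : ℝ) / n) • S.realRay v = fun j => (γ j : ℝ) := by
    rw [← inv_smul_smul₀ hn fun j => (γ j : ℝ), h.smul_eq_real, Finset.smul_sum]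
    simp only [smul_smul, div_eq_inv_mul]
  rw [cone_eq_image]
  refine ⟨fun ⟨c, hc, hcγ⟩ v hv => ?_, fun hσ₀ => ⟨_, coneCoords_mono hσ₀ coords_mem, sum_coords⟩⟩
  have hcw := hS.injOn (Set.mem_biUnion hσ hc) (Set.mem_biUnion h.mem_cones coords_mem)
    (hcγ.trans sum_coords.symm)
  by_contra hvσ
  have hw := congrFun hcw v
  rw [hc.2 v hvσ, eq_comm, div_eq_zero_iff, or_iff_left hn, Nat.cast_eq_zero] at hw
  exact (h.mem_iff v).1 hv hw

theorem mem_starSubdivision_cones (h : S.IsInteriorVector σ₀ γ n w) (hS : S.IsFan)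
    {ρ : Finset (Option ι)} :
    ρ ∈ (S.starSubdivision γ).cones ↔ ρ.eraseNone ∈ S.cones ∧ ¬ σ₀ ⊆ ρ.eraseNone ∧
      (none ∈ ρ → ∃ σ ∈ S.cones, ρ.eraseNone ⊆ σ ∧ σ₀ ⊆ σ) := by
  constructor
  · rintro (⟨σ, hσ, hγσ, rfl⟩ | ⟨τ, hτ, hγτ, ⟨σ, hσ, hτσ, hγσ⟩, rfl⟩)
    · rw [h.mem_cone_iff hS hσ] at hγσ
      simp [hσ, hγσ]
    · rw [h.mem_cone_iff hS hτ] at hγτ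
      rw [h.mem_cone_iff hS hσ] at hγσ
      simpa [hτ, hγτ] using ⟨σ, hσ, hτσ, hγσ⟩
  · rintro ⟨hτ, hγτ, hnone⟩
    rw [← h.mem_cone_iff hS hτ] at hγτ
    by_cases hn : none ∈ ρ
    · obtain ⟨σ, hσ, hτσ, hγσ⟩ := hnone hn
      rw [← h.mem_cone_iff hS hσ] at hγσ
      refine Or.inr ⟨ρ.eraseNone, hτ, hγτ, ⟨σ, hσ, hτσ, hγσ⟩, ?_⟩
      rw [Finset.insertNone_eraseNone, Finset.insert_eq_of_mem hn]
    · exact Or.inl ⟨ρ.eraseNone, hτ, hγτ, by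
        rw [Finset.map_some_eraseNone, Finset.erase_eq_of_notMem hn]⟩

theorem coneCoords_starSubdivision (h : S.IsInteriorVector σ₀ γ n w) (hS : S.IsFan)
    {ρ : Finset (Option ι)} (hρ : ρ ∈ (S.starSubdivision γ).cones) {c : Option ι → ℝ}
    (hc : c ∈ coneCoords ρ) :
    (fun v => n * c (some v) + w v * c none) ∈ ⋃ σ ∈ S.cones, coneCoords σ := by
  obtain ⟨hτ, -, hnone⟩ := (h.mem_starSubdivision_cones hS).1 hρ
  have nonneg (v : ι) : 0 ≤ n * c (some v) + w v * c none :=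
    add_nonneg (mul_nonneg n.cast_nonneg (hc.1 _)) (mul_nonneg (w v).cast_nonneg (hc.1 _))
  have eq_zero {v : ι} (hv : v ∉ ρ.eraseNone) : c (some v) = 0 := hc.2 _ (by simpa using hv)
  by_cases hn : none ∈ ρ
  · obtain ⟨σ, hσ, hτσ, hγσ⟩ := hnone hn
    refine Set.mem_biUnion hσ ⟨nonneg, fun v hv => ?_⟩
    simp [eq_zero (mt (@hτσ v) hv), not_not.1 (mt (h.mem_iff v).2 (mt (@hγσ v) hv))]
  · exact Set.mem_biUnion hτ ⟨nonneg, fun v hv => by simp [eq_zero hv, hc.2 _ hn]⟩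

theorem le_apply_none (h : S.IsInteriorVector σ₀ γ n w) (hS : S.IsFan)
    {ρ : Finset (Option ι)} (hρ : ρ ∈ (S.starSubdivision γ).cones) {c e : Option ι → ℝ}
    (hc : c ∈ coneCoords ρ) (he : ∀ v, 0 ≤ e v)
    (hce : ∀ v, n * c (some v) + w v * c none = n * e (some v) + w v * e none) :
    e none ≤ c none := by
  by_contra! hlt
  refine ((h.mem_starSubdivision_cones hS).1 hρ).2.1 fun v hv => ?_
  by_contra hvρ
  have hw : (0 : ℝ) < w v := by exact_mod_cast Nat.pos_of_ne_zero ((h.mem_iff v).1 hv)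
  have heq := hce v
  rw [hc.2 (some v) (by simpa using hvρ), mul_zero, zero_add] at heq
  exact (mul_lt_mul_of_pos_left hlt hw).not_ge
    (heq ▸ le_add_of_nonneg_left (mul_nonneg n.cast_nonneg (he _)))

theorem isFan_starSubdivision (h : S.IsInteriorVector σ₀ γ n w) (hS : S.IsFan)
    (hσ₀ : σ₀.Nontrivial) : (S.starSubdivision γ).IsFan := by
  refine isFan_of_injOn (fun ρ τ hτρ hρ => ?_) (fun v => ?_) ?_ ?_
  · rw [h.mem_starSubdivision_cones hS] at hρ ⊢
    have hsub := Finset.eraseNone.monotone hτρ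
    exact ⟨hS.isLowerSet hsub hρ.1, fun hτ => hρ.2.1 (hτ.trans hsub), fun hn =>
      (hρ.2.2 (hτρ hn)).imp fun σ hσ => ⟨hσ.1, hsub.trans hσ.2.1, hσ.2.2⟩⟩
  · rw [h.mem_starSubdivision_cones hS]
    cases v with
    | none =>
      have erase : Finset.eraseNone ({none} : Finset (Option ι)) = ∅ := by ext; simp
      rw [erase, Finset.subset_empty]
      exact ⟨hS.isLowerSet (Finset.empty_subset σ₀) h.mem_cones, hσ₀.nonempty.ne_empty,
        fun _ => ⟨σ₀, h.mem_cones, Finset.empty_subset _, subset_rfl⟩⟩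
    | some v =>
      have erase : Finset.eraseNone ({some v} : Finset (Option ι)) = {v} := by ext; simp
      rw [erase]
      exact ⟨hS.ray_mem v, hσ₀.not_subset_singleton, by simp⟩
  · rw [eq_top_iff, ← hS.span]
    refine Submodule.span_mono ?_
    rintro _ ⟨v, rfl⟩
    exact ⟨some v, rfl⟩
  · simp only [Set.InjOn, Set.mem_iUnion₂]
    rintro c ⟨ρ, hρ, hc⟩ e ⟨τ, hτ, he⟩ hce
    have old_eq := congrFun <| hS.injOn (h.coneCoords_starSubdivision hS hρ hc)
      (h.coneCoords_starSubdivision hS hτ he) (by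
        simp only [← h.sum_smul_starSubdivision]
        exact congrArg _ hce)
    have none_eq : c none = e none := le_antisymm
      (h.le_apply_none hS hτ he hc.1 fun v => (old_eq v).symm)
      (h.le_apply_none hS hρ hc he.1 old_eq)
    have hn : (n : ℝ) ≠ 0 := by exact_mod_cast h.pos.ne'
    funext v
    cases v with
    | none => exact none_eq
    | some v =>
      have := old_eq v
      simpa [none_eq, hn] using this

omit [DecidableEq ι] in
theorem mem_coxGroup_starSubdivision (h : S.IsInteriorVector σ₀ γ n w) {g : Option ι → ℂˣ} :
    g ∈ (S.starSubdivision γ).coxGroup ↔ ∃ s ∈ S.coxGroup, ∃ u : ℂˣ,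
      (∀ v, g (some v) = s v * u ^ w v) ∧ g none = (u ^ n)⁻¹ := by
  have key (s : ι → ℂˣ) (u : ℂˣ) (hs : ∀ v, g (some v) = s v * u ^ w v) (hu : g none = (u ^ n)⁻¹) :
      g ∈ (S.starSubdivision γ).coxGroup ↔ s ∈ S.coxGroup := by
    refine forall_congr' fun j => ?_
    have hγ : (n : ℤ) * γ j = ∑ v, (w v : ℤ) * S.ray v j := by
      simpa using congrFun h.smul_eq j
    have hnone : g none ^ γ j * ∏ v, (u ^ w v) ^ S.ray v j = 1 := by
      simp only [hu, inv_zpow, ← zpow_natCast, ← zpow_mul, hγ, inv_mul_eq_one]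
      exact map_sum (zmultiplesHom (Additive ℂˣ) (Additive.ofMul u)) _ _
    simp only [Fintype.prod_option, starSubdivision, Option.elim, hs, mul_zpow,
      Finset.prod_mul_distrib]
    rw [mul_left_comm, hnone, mul_one]
  constructor
  · intro hg
    obtain ⟨u, hu⟩ := exists_units_pow_eq h.pos (g none)⁻¹
    have hs (v : ι) : g (some v) = g (some v) * (u ^ w v)⁻¹ * u ^ w v :=
      (inv_mul_cancel_right _ _).symm
    have hu' : g none = (u ^ n)⁻¹ := by rw [hu, inv_inv]
    exact ⟨_, (key _ u hs hu').1 hg, u, hs, hu'⟩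
  · rintro ⟨s, hs, u, hgs, hu⟩
    exact (key s u hgs hu).2 hs

end IsInteriorVector

end StackyFan

/-! ### The fan of the weighted bundle -/

section BundleFan

variable {m : ℕ} {ω a b : Fin (m + 1) → ℕ} {k : Fin (m + 1)}

/-- The first row of the weight matrix of the weighted bundle. -/
def baseDegree (ω : Fin (m + 1) → ℕ) : BundleVar m → ℤ :=
  Sum.elim (fun _ => 1) fun i => -(ω i : ℤ)

/-- The second row of the weight matrix of the weighted bundle. -/
def fibreDegree (a : Fin (m + 1) → ℕ) : BundleVar m → ℕ :=
  Sum.elim (fun _ => 0) a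

theorem sum_baseDegree_smul_ray : ∑ v, baseDegree ω v • (bundleFan ω a).ray v = 0 := by
  simp only [bundleFan, baseDegree, Fintype.sum_sum_type, Fin.sum_univ_two, Sum.elim_inl,
    Sum.elim_inr, Matrix.cons_val_zero, Matrix.cons_val_one, one_smul, neg_smul,
    Finset.sum_neg_distrib]
  abel

theorem sum_fibreDegree_smul_ray (ha0 : a 0 = 1) :
    ∑ v, (fibreDegree a v : ℤ) • (bundleFan ω a).ray v = 0 := by
  rw [Fintype.sum_sum_type, ← Finset.add_sum_erase _ _ (Finset.mem_univ (0 : Fin (m + 1)))]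
  have tail : ∀ i ∈ Finset.univ.erase (0 : Fin (m + 1)),
      (fibreDegree a (Sum.inr i) : ℤ) • (bundleFan ω a).ray (Sum.inr i) =
        (a i : ℤ) • Pi.single i 1 := fun i hi => by
    simp [bundleFan, fibreDegree, Finset.ne_of_mem_erase hi]
  rw [Finset.sum_congr rfl tail]
  simp [bundleFan, fibreDegree, ha0]

theorem eq_zero_of_sum_ray_smul_eq_zero {M : Type*} [AddCommGroup M] {c : BundleVar m → M}
    (hx : c (Sum.inl 0) = 0) (hy : c (Sum.inr 0) = 0)
    (hc : ∀ j, ∑ v, (bundleFan ω a).ray v j • c v = 0) : c = 0 := by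
  have coord (j : Fin (m + 1)) : ∑ v, (bundleFan ω a).ray v j • c v =
      if j = 0 then c (Sum.inl 1) else c (Sum.inr j) := by
    cases j using Fin.cases <;>
      simp [Fin.sum_univ_succ (n := m), bundleFan, hx, hy, Pi.single_apply, Fin.succ_ne_zero,
        ite_smul, (Fin.succ_ne_zero _).symm]
  funext v
  rcases v with v | v
  · fin_cases v
    · exact hx
    · simpa [coord] using hc 0
  · by_cases hv : v = 0
    · rw [hv, hy, Pi.zero_apply]
    · simpa [coord, hv] using hc v

theorem sum_ray_smul_eq_zero_iff (ha0 : a 0 = 1) {M : Type*} [AddCommGroup M]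
    {c : BundleVar m → M} :
    (∀ j, ∑ v, (bundleFan ω a).ray v j • c v = 0) ↔
      ∃ s t : M, ∀ v, c v = baseDegree ω v • s + (fibreDegree a v : ℤ) • t := by
  have relation (s t : M) (j : Fin (m + 1)) : ∑ v, (bundleFan ω a).ray v j •
      (baseDegree ω v • s + (fibreDegree a v : ℤ) • t) = 0 := by
    have hs := congrFun (sum_baseDegree_smul_ray (ω := ω) (a := a)) j
    have ht := congrFun (sum_fibreDegree_smul_ray (ω := ω) ha0) j
    simp only [Finset.sum_apply, Pi.smul_apply, smul_eq_mul, mul_comm _ ((bundleFan ω a).ray _ _),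
      Pi.zero_apply] at hs ht
    simp only [smul_add, smul_smul, Finset.sum_add_distrib, ← Finset.sum_smul, hs, ht, zero_smul,
      add_zero]
  constructor
  · intro hc
    set s := c (Sum.inl 0)
    set t := c (Sum.inr 0) + (ω 0 : ℤ) • s with ht
    have diff_eq_zero := eq_zero_of_sum_ray_smul_eq_zero (ω := ω) (a := a)
      (c := fun v => c v - (baseDegree ω v • s + (fibreDegree a v : ℤ) • t))
      (by simp [s, baseDegree, fibreDegree])
      (by simp [ht, baseDegree, fibreDegree, ha0])
      fun j => by simp only [smul_sub, Finset.sum_sub_distrib, hc j, relation, sub_zero]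
    exact ⟨s, t, fun v => sub_eq_zero.1 (congrFun diff_eq_zero v)⟩
  · rintro ⟨s, t, hc⟩ j
    simp only [hc, relation]

theorem mem_bundleFan_cones {σ : Finset (BundleVar m)} : σ ∈ (bundleFan ω a).cones ↔
    (∃ s, Sum.inl s ∉ σ) ∧ ∃ i, Sum.inr i ∉ σ := by
  simp [bundleFan]

theorem isLowerSet_bundleFan_cones : IsLowerSet (bundleFan ω a).cones := by
  intro σ τ hτσ hσ
  rw [mem_bundleFan_cones] at hσ ⊢
  exact ⟨hσ.1.imp fun _ => mt (@hτσ _), hσ.2.imp fun _ => mt (@hτσ _)⟩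

theorem singleton_mem_bundleFan_cones (hm : m ≠ 0) (v : BundleVar m) :
    {v} ∈ (bundleFan ω a).cones := by
  have : Nontrivial (Fin (m + 1)) := Fin.nontrivial_iff_two_le.2 (by omega)
  rw [mem_bundleFan_cones]
  rcases v with v | v
  · simpa using exists_ne v
  · simpa using exists_ne v

theorem span_realRay_bundleFan :
    Submodule.span ℝ (Set.range (bundleFan ω a).realRay) = ⊤ := by
  rw [eq_top_iff, ← (Pi.basisFun ℝ (Fin (m + 1))).span_eq, Submodule.span_le]
  rintro _ ⟨i, rfl⟩
  apply Submodule.subset_span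
  by_cases hi : i = 0
  · exact ⟨Sum.inl 1, by ext j; simp [StackyFan.realRay, bundleFan, hi, Pi.single_apply]⟩
  · exact ⟨Sum.inr i, by ext j; simp [StackyFan.realRay, bundleFan, hi, Pi.single_apply]⟩

theorem injOn_coneCoords_bundleFan (ha0 : a 0 = 1) (ha : ∀ i, 0 < a i) :
    Set.InjOn (fun c => ∑ v, c v • (bundleFan ω a).realRay v)
      (⋃ σ ∈ (bundleFan ω a).cones, StackyFan.coneCoords σ) := by
  simp only [Set.InjOn, Set.mem_iUnion₂, mem_bundleFan_cones]
  rintro c ⟨σ, ⟨⟨p, hp⟩, i, hi⟩, hc⟩ e ⟨τ, ⟨⟨q, hq⟩, j, hj⟩, he⟩ hce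
  have relation (j : Fin (m + 1)) : ∑ v, (bundleFan ω a).ray v j • (c v - e v) = 0 := by
    simp only [smul_sub, Finset.sum_sub_distrib, sub_eq_zero]
    simpa [StackyFan.realRay, mul_comm] using congrFun hce j
  obtain ⟨s, t, hst⟩ := (sum_ray_smul_eq_zero_iff ha0).1 relation
  have hbase (p : Fin 2) : c (Sum.inl p) - e (Sum.inl p) = s := by
    simpa [baseDegree, fibreDegree] using hst (Sum.inl p)
  have s_eq_zero : s = 0 := le_antisymm
    (by linarith [hbase p, hc.2 _ hp, he.1 (Sum.inl p)])
    (by linarith [hbase q, he.2 _ hq, hc.1 (Sum.inl q)])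
  have hfibre (i : Fin (m + 1)) : c (Sum.inr i) - e (Sum.inr i) = a i * t := by
    simpa [baseDegree, fibreDegree, s_eq_zero] using hst (Sum.inr i)
  have ha' (i : Fin (m + 1)) : (0 : ℝ) < a i := by exact_mod_cast ha i
  have t_eq_zero : t = 0 := le_antisymm
    (nonpos_of_mul_nonpos_right (by linarith [hfibre i, hc.2 _ hi, he.1 (Sum.inr i)]) (ha' i))
    (nonneg_of_mul_nonneg_right (by linarith [hfibre j, he.2 _ hj, hc.1 (Sum.inr j)]) (ha' j))
  funext v
  simpa [s_eq_zero, t_eq_zero, sub_eq_zero] using hst v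

theorem isFan_bundleFan (hm : m ≠ 0) (ha0 : a 0 = 1) (ha : ∀ i, 0 < a i) :
    (bundleFan ω a).IsFan :=
  StackyFan.isFan_of_injOn isLowerSet_bundleFan_cones (singleton_mem_bundleFan_cones hm)
    span_realRay_bundleFan (injOn_coneCoords_bundleFan ha0 ha)

theorem mem_span_range_X_iff {κ ι : Type} (f : κ → ι) {p : MvPolynomial ι ℂ} :
    p ∈ Ideal.span (Set.range fun i => (X (f i) : MvPolynomial ι ℂ)) ↔
      ∀ n ∈ p.support, ∃ i, n (f i) ≠ 0 := by
  rw [← Function.comp_def, Set.range_comp, mem_ideal_span_X_image]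
  simp

theorem mem_span_pair_X_iff {ι : Type} (i j : ι) {p : MvPolynomial ι ℂ} :
    p ∈ Ideal.span {X i, X j} ↔ ∀ n ∈ p.support, n i ≠ 0 ∨ n j ≠ 0 := by
  rw [← Set.image_pair, mem_ideal_span_X_image]
  simp

theorem irrelevantIdeal_bundleFan :
    (bundleFan ω a).irrelevantIdeal = (weightedBundle ω a).irrelevantIdeal := by
  ext p
  simp only [StackyFan.mem_irrelevantIdeal_iff isLowerSet_bundleFan_cones, mem_bundleFan_cones,
    weightedBundle, Ideal.mem_inf, mem_span_pair_X_iff, mem_span_range_X_iff, ← forall₂_and,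
    Finset.mem_compl, Finsupp.mem_support_iff, not_not, Fin.exists_fin_two]

theorem weightHom_weightedBundle_apply (x : Fin 2 → ℂˣ) (v : BundleVar m) :
    weightHom (weightedBundle ω a).weights x v =
      x 0 ^ baseDegree ω v * x 1 ^ fibreDegree a v := by
  rcases v with v | v <;> simp [weightHom, weightedBundle, baseDegree, fibreDegree]

theorem weightHom_weightedBundle_injective (ha0 : a 0 = 1) :
    Function.Injective (weightHom (weightedBundle ω a).weights) := by
  rw [injective_iff_map_eq_one]
  intro x hx
  have x_zero : x 0 = 1 := by
    simpa [weightHom_weightedBundle_apply, baseDegree, fibreDegree] using congrFun hx (Sum.inl 0)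
  have x_one : x 1 = 1 := by
    simpa [weightHom_weightedBundle_apply, baseDegree, fibreDegree, x_zero, ha0] using
      congrFun hx (Sum.inr 0)
  funext i
  fin_cases i
  · exact x_zero
  · exact x_one

theorem mem_group_weightedBundle {g : BundleVar m → ℂˣ} : g ∈ (weightedBundle ω a).group ↔
    ∃ s t : ℂˣ, ∀ v, g v = s ^ baseDegree ω v * t ^ fibreDegree a v := by
  constructor
  · rintro ⟨x, rfl⟩
    exact ⟨x 0, x 1, weightHom_weightedBundle_apply x⟩
  · rintro ⟨s, t, hg⟩
    exact ⟨![s, t], funext fun v => by rw [weightHom_weightedBundle_apply, hg]; rfl⟩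

theorem coxGroup_bundleFan (ha0 : a 0 = 1) :
    (bundleFan ω a).coxGroup = (weightedBundle ω a).group := by
  ext g
  have additive : g ∈ (bundleFan ω a).coxGroup ↔
      ∀ j, ∑ v, (bundleFan ω a).ray v j • Additive.ofMul (g v) = 0 :=
    forall_congr' fun j => by rw [← ofMul_eq_zero, ofMul_prod]; rfl
  rw [additive, sum_ray_smul_eq_zero_iff ha0, mem_group_weightedBundle]
  simp only [natCast_zsmul]
  rfl

end BundleFan

section BundleSubdivision

variable {m : ℕ} {ω a b : Fin (m + 1) → ℕ} {k : Fin (m + 1)} {γ : Fin (m + 1) → ℤ}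

theorem blowUpWeight_ne_zero_iff (hb : ∀ i, 0 < b i) {v : BundleVar m} :
    blowUpWeight k b v ≠ 0 ↔ v ≠ Sum.inl 1 ∧ v ≠ Sum.inr k := by
  rcases v with v | v
  · fin_cases v <;> simp [blowUpWeight, (hb k).ne']
  · simp [blowUpWeight, (hb v).ne']

theorem blowUpWeight_modEq_fibreDegree (hbi : ∀ i, i ≠ k → b i ≡ a i [MOD a k])
    (hbk : a k ∣ b k) (v : BundleVar m) : blowUpWeight k b v ≡ fibreDegree a v [MOD a k] := by
  rcases v with v | v
  · fin_cases v
    · exact Nat.modEq_zero_iff_dvd.2 hbk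
    · rfl
  · by_cases hv : v = k
    · subst hv
      simp [blowUpWeight, fibreDegree, Nat.ModEq]
    · simpa [blowUpWeight, fibreDegree, hv] using hbi v hv

theorem exists_smul_eq_sum_blowUpWeight_smul_ray (ha0 : a 0 = 1)
    (hbw : ∀ v, blowUpWeight k b v ≡ fibreDegree a v [MOD a k]) : ∃ γ : Fin (m + 1) → ℤ,
      (a k : ℤ) • γ = ∑ v, (blowUpWeight k b v : ℤ) • (bundleFan ω a).ray v := by
  choose q hq using fun v => Nat.modEq_iff_dvd.1 (hbw v).symm
  refine ⟨∑ v, q v • (bundleFan ω a).ray v, ?_⟩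
  simp only [Finset.smul_sum, smul_smul, ← hq, sub_smul, Finset.sum_sub_distrib,
    sum_fibreDegree_smul_ray ha0, sub_zero]

/-- The cone of the fan of the weighted bundle that corresponds to the point at which all the
variables other than `x_1` and `y_k` vanish. -/
def baseCone (k : Fin (m + 1)) : Finset (BundleVar m) :=
  {Sum.inl 1, Sum.inr k}ᶜ

theorem mem_baseCone {v : BundleVar m} : v ∈ baseCone k ↔ v ≠ Sum.inl 1 ∧ v ≠ Sum.inr k := by
  simp [baseCone]

theorem baseCone_subset_iff {σ : Finset (BundleVar m)} :
    baseCone k ⊆ σ ↔ Sum.inl 0 ∈ σ ∧ ∀ i, i ≠ k → Sum.inr i ∈ σ := by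
  simp [Finset.subset_iff, mem_baseCone, Fin.forall_fin_two]

theorem nontrivial_baseCone (hm : m ≠ 0) : (baseCone k).Nontrivial := by
  have : Nontrivial (Fin (m + 1)) := Fin.nontrivial_iff_two_le.2 (by omega)
  obtain ⟨i, hi⟩ := exists_ne k
  exact ⟨Sum.inl 0, by simp [mem_baseCone], Sum.inr i, by simpa [mem_baseCone], by simp⟩

theorem isInteriorVector_baseCone (hak : 0 < a k) (hb : ∀ i, 0 < b i)
    (hγ : (a k : ℤ) • γ = ∑ v, (blowUpWeight k b v : ℤ) • (bundleFan ω a).ray v) :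
    (bundleFan ω a).IsInteriorVector (baseCone k) γ (a k) (blowUpWeight k b) where
  pos := hak
  smul_eq := hγ
  mem_cones := mem_bundleFan_cones.2 ⟨⟨1, by simp [mem_baseCone]⟩, k, by simp [mem_baseCone]⟩
  mem_iff _ := mem_baseCone.trans (blowUpWeight_ne_zero_iff hb).symm

theorem exists_bundleFan_cone_iff {τ : Finset (BundleVar m)} :
    (∃ σ ∈ (bundleFan ω a).cones, τ ⊆ σ ∧ baseCone k ⊆ σ) ↔ Sum.inl 1 ∉ τ ∧ Sum.inr k ∉ τ := by
  constructor
  · rintro ⟨σ, hσ, hτσ, hγσ⟩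
    obtain ⟨⟨p, hp⟩, i, hi⟩ := mem_bundleFan_cones.1 hσ
    have hp1 : p = 1 := by simpa [mem_baseCone] using mt (@hγσ _) hp
    have hik : i = k := by simpa [mem_baseCone] using mt (@hγσ _) hi
    exact ⟨mt (@hτσ _) (hp1 ▸ hp), mt (@hτσ _) (hik ▸ hi)⟩
  · rintro ⟨h1, hk⟩
    refine ⟨baseCone k, mem_bundleFan_cones.2 ⟨⟨1, by simp [mem_baseCone]⟩, k,
      by simp [mem_baseCone]⟩, fun v hv => mem_baseCone.2 ⟨?_, ?_⟩, subset_rfl⟩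
    · exact fun h => h1 (h ▸ hv)
    · exact fun h => hk (h ▸ hv)

theorem mem_cones_starSubdivision_bundleFan (hm : m ≠ 0) (ha0 : a 0 = 1) (ha : ∀ i, 0 < a i)
    (hb : ∀ i, 0 < b i)
    (hγ : (a k : ℤ) • γ = ∑ v, (blowUpWeight k b v : ℤ) • (bundleFan ω a).ray v)
    {ρ : Finset (BlowUpVar m)} :
    ρ ∈ ((bundleFan ω a).starSubdivision γ).cones ↔
      ((∃ s, some (Sum.inl s) ∉ ρ) ∧ ∃ i, some (Sum.inr i) ∉ ρ) ∧
      (some (Sum.inl 0) ∉ ρ ∨ ∃ i, i ≠ k ∧ some (Sum.inr i) ∉ ρ) ∧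
      (none ∈ ρ → some (Sum.inl 1) ∉ ρ ∧ some (Sum.inr k) ∉ ρ) := by
  rw [(isInteriorVector_baseCone (ha k) hb hγ).mem_starSubdivision_cones
    (isFan_bundleFan hm ha0 ha), exists_bundleFan_cone_iff, baseCone_subset_iff,
    mem_bundleFan_cones, not_and_or]
  simp

theorem isFan_starSubdivision_bundleFan (hm : m ≠ 0) (ha0 : a 0 = 1) (ha : ∀ i, 0 < a i)
    (hb : ∀ i, 0 < b i)
    (hγ : (a k : ℤ) • γ = ∑ v, (blowUpWeight k b v : ℤ) • (bundleFan ω a).ray v) :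
    ((bundleFan ω a).starSubdivision γ).IsFan :=
  (isInteriorVector_baseCone (ha k) hb hγ).isFan_starSubdivision (isFan_bundleFan hm ha0 ha)
    (nontrivial_baseCone hm)

theorem insert_X_eq_image : (insert (X (some (Sum.inl 0)))
    {p | ∃ i, i ≠ k ∧ p = X (some (Sum.inr i))} : Set (MvPolynomial (BlowUpVar m) ℂ)) =
      X '' insert (some (Sum.inl 0)) ((fun i => some (Sum.inr i)) '' {k}ᶜ) := by
  rw [Set.image_insert_eq, Set.image_image]
  congr 1
  ext p
  simp [eq_comm]

theorem irrelevantIdeal_starSubdivision_bundleFan (hm : m ≠ 0) (ha0 : a 0 = 1)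
    (ha : ∀ i, 0 < a i) (hb : ∀ i, 0 < b i)
    (hγ : (a k : ℤ) • γ = ∑ v, (blowUpWeight k b v : ℤ) • (bundleFan ω a).ray v) :
    ((bundleFan ω a).starSubdivision γ).irrelevantIdeal =
      (rankThreeStack ω a k b).irrelevantIdeal := by
  have lower := (isFan_starSubdivision_bundleFan hm ha0 ha hb hγ).isLowerSet
  ext p
  simp only [StackyFan.mem_irrelevantIdeal_iff lower,
    mem_cones_starSubdivision_bundleFan hm ha0 ha hb hγ, rankThreeStack, insert_X_eq_image,
    Ideal.mem_inf, mem_span_pair_X_iff, mem_span_range_X_iff, mem_ideal_span_X_image, ← forall₂_and]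
  refine forall₂_congr fun n _ => ?_
  simp only [Finset.mem_compl, Finsupp.mem_support_iff, ne_eq, Decidable.not_not,
    Fin.exists_fin_two, Set.mem_insert_iff, Set.mem_image, Set.mem_compl_iff, Set.mem_singleton_iff,
    exists_eq_or_imp, ↓existsAndEq, and_true]
  tauto

theorem weightHom_rankThreeStack_none (x : Fin 3 → ℂˣ) :
    weightHom (rankThreeStack ω a k b).weights x none = (x 2 ^ a k)⁻¹ := by
  simp [weightHom, rankThreeStack, Fin.prod_univ_three]

theorem weightHom_rankThreeStack_some (x : Fin 3 → ℂˣ) (v : BundleVar m) :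
    weightHom (rankThreeStack ω a k b).weights x (some v) =
      weightHom (weightedBundle ω a).weights ![x 0, x 1] v * x 2 ^ blowUpWeight k b v := by
  simp [weightHom, rankThreeStack, Fin.prod_univ_three]

theorem mem_group_rankThreeStack {g : BlowUpVar m → ℂˣ} :
    g ∈ (rankThreeStack ω a k b).group ↔ ∃ h ∈ (weightedBundle ω a).group, ∃ u : ℂˣ,
      (∀ v, g (some v) = h v * u ^ blowUpWeight k b v) ∧ g none = (u ^ a k)⁻¹ := by
  constructor
  · rintro ⟨x, rfl⟩
    exact ⟨_, ⟨![x 0, x 1], rfl⟩, x 2, weightHom_rankThreeStack_some x,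
      weightHom_rankThreeStack_none x⟩
  · rintro ⟨_, ⟨x, rfl⟩, u, hsome, hnone⟩
    have eta : ![x 0, x 1] = x := by ext i; fin_cases i <;> rfl
    refine ⟨![x 0, x 1, u], funext fun v => ?_⟩
    cases v with
    | none => rw [weightHom_rankThreeStack_none, hnone]; rfl
    | some v => rw [weightHom_rankThreeStack_some, hsome, ← eta]; rfl

theorem coxGroup_starSubdivision_bundleFan (ha0 : a 0 = 1) (hak : 0 < a k) (hb : ∀ i, 0 < b i)
    (hγ : (a k : ℤ) • γ = ∑ v, (blowUpWeight k b v : ℤ) • (bundleFan ω a).ray v) :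
    ((bundleFan ω a).starSubdivision γ).coxGroup = (rankThreeStack ω a k b).group := by
  ext g
  rw [(isInteriorVector_baseCone hak hb hγ).mem_coxGroup_starSubdivision, coxGroup_bundleFan ha0,
    mem_group_rankThreeStack]

theorem weightHom_rankThreeStack_some_of_pow_eq_one
    (hbw : ∀ v, blowUpWeight k b v ≡ fibreDegree a v [MOD a k]) {x : Fin 3 → ℂˣ}
    (hx : x 2 ^ a k = 1) (v : BundleVar m) :
    weightHom (rankThreeStack ω a k b).weights x (some v) =
      weightHom (weightedBundle ω a).weights ![x 0, x 1 * x 2] v := by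
  rw [weightHom_rankThreeStack_some, pow_eq_pow_of_modEq (hbw v) hx]
  simp only [weightHom_weightedBundle_apply, Matrix.cons_val_zero, Matrix.cons_val_one, mul_pow,
    mul_assoc]

theorem mem_ker_weightHom_rankThreeStack (ha0 : a 0 = 1)
    (hbw : ∀ v, blowUpWeight k b v ≡ fibreDegree a v [MOD a k]) {x : Fin 3 → ℂˣ} :
    x ∈ (weightHom (rankThreeStack ω a k b).weights).ker ↔
      x = ![1, (x 2)⁻¹, x 2] ∧ x 2 ^ a k = 1 := by
  have root_iff : x 2 ^ a k = 1 ↔ weightHom (rankThreeStack ω a k b).weights x none = 1 := by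
    rw [weightHom_rankThreeStack_none, inv_eq_one]
  have bundle_iff (hx : x 2 ^ a k = 1) :
      (∀ v, weightHom (rankThreeStack ω a k b).weights x (some v) = 1) ↔
        x = ![1, (x 2)⁻¹, x 2] := by
    simp only [weightHom_rankThreeStack_some_of_pow_eq_one hbw hx]
    refine _root_.funext_iff.symm.trans
      ((map_eq_one_iff _ (weightHom_weightedBundle_injective ha0)).trans ?_)
    simp [_root_.funext_iff, Fin.forall_fin_succ, eq_inv_iff_mul_eq_one]
  rw [MonoidHom.mem_ker, _root_.funext_iff, Option.forall, Pi.one_apply, ← root_iff, and_comm]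
  exact and_congr_left bundle_iff

/-- The generic stabiliser of the rank 3 stack is the group of `a_k`-th roots of unity in the last
factor of the torus. -/
noncomputable def kerEquivRootsOfUnity (ha0 : a 0 = 1)
    (hbw : ∀ v, blowUpWeight k b v ≡ fibreDegree a v [MOD a k]) :
    (weightHom (rankThreeStack ω a k b).weights).ker ≃* rootsOfUnity (a k) ℂ where
  toFun x := ⟨x.1 2, ((mem_ker_weightHom_rankThreeStack ha0 hbw).1 x.2).2⟩
  invFun u := ⟨![1, u.1⁻¹, u.1], (mem_ker_weightHom_rankThreeStack ha0 hbw).2 ⟨rfl, u.2⟩⟩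
  left_inv x := Subtype.ext ((mem_ker_weightHom_rankThreeStack ha0 hbw).1 x.2).1.symm
  right_inv _ := rfl
  map_mul' _ _ := rfl

theorem isCyclic_ker_weightHom_rankThreeStack (ha0 : a 0 = 1) (hak : 0 < a k)
    (hbw : ∀ v, blowUpWeight k b v ≡ fibreDegree a v [MOD a k]) :
    IsCyclic (weightHom (rankThreeStack ω a k b).weights).ker :=
  have : NeZero (a k) := ⟨hak.ne'⟩
  (kerEquivRootsOfUnity ha0 hbw).isCyclic.2 inferInstance

theorem card_ker_weightHom_rankThreeStack (ha0 : a 0 = 1) (hak : 0 < a k)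
    (hbw : ∀ v, blowUpWeight k b v ≡ fibreDegree a v [MOD a k]) :
    Nat.card (weightHom (rankThreeStack ω a k b).weights).ker = a k :=
  have : NeZero (a k) := ⟨hak.ne'⟩
  (Nat.card_congr (kerEquivRootsOfUnity ha0 hbw).toEquiv).trans <|
    Complex.card_rootsOfUnity (a k)

theorem rank_weights_rankThreeStack (hak : a k ≠ 0) :
    ((rankThreeStack ω a k b).weights.map (Int.cast : ℤ → ℚ)).rank = 3 := by
  refine (LinearIndependent.rank_matrix ?_).trans (Fintype.card_fin 3)
  rw [Fintype.linearIndependent_iff]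
  intro g hg
  have hX := congrFun hg (some (Sum.inl 1))
  have hY := congrFun hg (some (Sum.inr k))
  have hξ := congrFun hg none
  simp only [Finset.sum_apply, Pi.smul_apply, Matrix.row, Matrix.map_apply, Fin.sum_univ_three]
    at hX hY hξ
  have g_zero : g 0 = 0 := by simpa [rankThreeStack, weightedBundle, blowUpWeight] using hX
  have g_one : g 1 = 0 := by
    simpa [rankThreeStack, weightedBundle, blowUpWeight, g_zero, hak] using hY
  have g_two : g 2 = 0 := by simpa [rankThreeStack, hak] using hξ
  intro i
  fin_cases i <;> assumption

end BundleSubdivision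

section RootsOfUnity

theorem exists_units_mul_eq_of_pow_eq_pow {n : ℕ} (hn : n ≠ 0) {x y : ℂ} (h : x ^ n = y ^ n) :
    ∃ u : ℂˣ, u ^ n = 1 ∧ x = u * y := by
  obtain rfl | hy := eq_or_ne y 0
  · exact ⟨1, one_pow n, by simpa [hn] using h⟩
  · have hx : x ≠ 0 := fun hx => pow_ne_zero n hy (by rw [← h, hx, zero_pow hn])
    refine ⟨Units.mk0 x hx / Units.mk0 y hy, Units.ext ?_, ?_⟩
    · simp [div_pow, h, hy]
    · simp [hy]

theorem pow_eq_pow_mod_mul_pow_div {M : Type*} [Monoid M] {x y : M} {n : ℕ} (h : x ^ n = y)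
    (d : ℕ) : x ^ d = x ^ (d % n) * y ^ (d / n) := by
  rw [← h, ← pow_mul, ← pow_add, Nat.mod_add_div]

variable {ι : Type} [Fintype ι] {G : Subgroup (ι → ℂˣ)} {n : ℕ}

theorem SameWeight.modEq {S : Finset (ι →₀ ℕ)} (hS : SameWeight G S) (hn : n ≠ 0) {c : ι → ℕ}
    (hc : ∀ ε : ℂˣ, ε ^ n = 1 → (fun i => ε ^ c i) ∈ G) {d d' : ι →₀ ℕ} (hd : d ∈ S)
    (hd' : d' ∈ S) : ∑ i, c i * d i ≡ ∑ i, c i * d' i [MOD n] := by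
  have primitive := (Complex.isPrimitiveRoot_exp n hn).isUnit_unit hn
  have eq := hS d hd d' hd' _ (hc _ primitive.pow_eq_one)
  simp only [← pow_mul, Finset.prod_pow_eq_pow_sum] at eq
  rwa [pow_eq_pow_iff_modEq, ← primitive.eq_orderOf] at eq

end RootsOfUnity

section Lift

variable {ι : Type} {I : Ideal (MvPolynomial ι ℂ)} {G : Subgroup (ι → ℂˣ)} {α : Type*}

/-- The map out of `(ℂ^ι - V(I)) / G` induced by a `G`-invariant function of the homogeneous
coordinates. -/
def quotientSpace.lift (f : ∀ z ∈ stableLocus I, α)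
    (hf : ∀ z hz, ∀ t ∈ G, ∀ hz', f (t • z) hz' = f z hz) : quotientSpace I G → α :=
  Quotient.lift (fun z => f z.1 z.2) fun z w hzw => by
    obtain ⟨t, ht, h⟩ := quotientSpace.mk_eq_mk.1 (Quotient.sound hzw)
    have := hf z.1 z.2 t ht (h ▸ w.2)
    simpa only [← h] using this.symm

end Lift

section StableLoci

variable {m : ℕ} {ω a b : Fin (m + 1) → ℕ} {k : Fin (m + 1)}

theorem isTorusInvariant_top {ι : Type} :
    IsTorusInvariant (⊤ : Ideal (MvPolynomial ι ℂ)) := fun _ _ _ => by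
  simp [stableLocus, zeroLocus_top]

theorem mem_stableLocus_weightedBundle {z : BundleVar m → ℂ} :
    z ∈ stableLocus (weightedBundle ω a).irrelevantIdeal ↔
      (z (Sum.inl 0) ≠ 0 ∨ z (Sum.inl 1) ≠ 0) ∧ ∃ i, z (Sum.inr i) ≠ 0 := by
  simp [weightedBundle, mem_stableLocus_inf, mem_stableLocus_span]

theorem isTorusInvariant_weightedBundle :
    IsTorusInvariant (weightedBundle ω a).irrelevantIdeal := fun z hz t => by
  simpa [mem_stableLocus_weightedBundle, Units.smul_def] using
    mem_stableLocus_weightedBundle.1 hz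

theorem exists_chartVar {p : BundleVar m → Prop} :
    (∃ v : ChartVar k, p v.1) ↔ p (Sum.inl 0) ∨ ∃ i, i ≠ k ∧ p (Sum.inr i) := by
  simp [Fin.exists_fin_two]

theorem mem_stableLocus_rankThreeStack {z : BlowUpVar m → ℂ} :
    z ∈ stableLocus (rankThreeStack ω a k b).irrelevantIdeal ↔
      (fun v => z (some v)) ∈ stableLocus (weightedBundle ω a).irrelevantIdeal ∧
      (z none = 0 → z (some (Sum.inl 1)) ≠ 0 ∧ z (some (Sum.inr k)) ≠ 0) ∧
      ∃ v : ChartVar k, z (some v.1) ≠ 0 := by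
  simp only [rankThreeStack, mem_stableLocus_inf, mem_stableLocus_span,
    mem_stableLocus_weightedBundle, insert_X_eq_image,
    exists_chartVar (k := k) (p := fun v => z (some v) ≠ 0)]
  simp only [Set.mem_insert_iff, Set.mem_singleton_iff, ne_eq, exists_eq_or_imp, eval_X,
    ↓existsAndEq, true_and, Set.mem_range, exists_exists_eq_and, Set.mem_image, Set.mem_compl_iff,
    and_true, exists_eq_or_imp']
  tauto

theorem isTorusInvariant_rankThreeStack :
    IsTorusInvariant (rankThreeStack ω a k b).irrelevantIdeal := fun z hz t => by
  obtain ⟨bundle, center, chart⟩ := mem_stableLocus_rankThreeStack.1 hz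
  refine mem_stableLocus_rankThreeStack.2 ⟨isTorusInvariant_weightedBundle _ bundle
    (fun v => t (some v)), ?_, ?_⟩
  · simpa [Units.smul_def] using center
  · simpa [Units.smul_def] using chart

theorem mem_stableLocus_span_X_some {δ : Type} {z : Option δ → ℂ} :
    z ∈ stableLocus
      (Ideal.span (Set.range fun i : δ => (X (some i) : MvPolynomial (Option δ) ℂ))) ↔
      ∃ i, z (some i) ≠ 0 := by
  simp [mem_stableLocus_span]

theorem isTorusInvariant_span_X_some {δ : Type} : IsTorusInvariant
    (Ideal.span (Set.range fun i : δ => (X (some i) : MvPolynomial (Option δ) ℂ))) :=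
  fun z hz t => by
    simpa [mem_stableLocus_span_X_some, Units.smul_def] using mem_stableLocus_span_X_some.1 hz

end StableLoci

/-! ### The chart at the point `p` -/

section ChartPoint

variable {m : ℕ} {a : Fin (m + 1) → ℕ} {k : Fin (m + 1)}

@[simp]
theorem chartPoint_inl_one (z : ChartVar k → ℂ) : chartPoint z (Sum.inl 1) = 1 := by
  simp [chartPoint]

@[simp]
theorem chartPoint_inr_self (z : ChartVar k → ℂ) : chartPoint z (Sum.inr k) = 1 := by
  simp [chartPoint]

@[simp]
theorem chartPoint_coe (z : ChartVar k → ℂ) (v : ChartVar k) : chartPoint z v.1 = z v := by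
  simp [chartPoint, v.2]

theorem eq_chartPoint_iff {z : BundleVar m → ℂ} {w : ChartVar k → ℂ} :
    z = chartPoint w ↔ z (Sum.inl 1) = 1 ∧ z (Sum.inr k) = 1 ∧ ∀ v : ChartVar k, z v.1 = w v := by
  refine ⟨by rintro rfl; simp, fun ⟨h1, hk, hw⟩ => funext fun v => ?_⟩
  by_cases hv : v ≠ Sum.inl 1 ∧ v ≠ Sum.inr k
  · simpa [chartPoint, hv] using hw ⟨v, hv⟩
  · rw [chartPoint, dif_neg hv]
    obtain rfl | rfl : v = Sum.inl 1 ∨ v = Sum.inr k := by tauto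
    exacts [h1, hk]

theorem basePoint_eq_chartPoint_zero : basePoint k = chartPoint (0 : ChartVar k → ℂ) := by
  refine eq_chartPoint_iff.2 ⟨by simp [basePoint], by simp [basePoint], ?_⟩
  rintro ⟨v | i, h1, hk⟩
  · obtain rfl : v = 0 := by grind
    simp [basePoint]
  · simpa [basePoint, Pi.single_apply] using hk

theorem chartPoint_smul {ε : ℂˣ} (hε : ε ^ a k = 1) (z : ChartVar k → ℂ) :
    chartPoint ((fun v => ε ^ chartType a k v) • z) =
      (fun v => ε ^ fibreDegree a v) • chartPoint z :=
  (eq_chartPoint_iff.2 ⟨by simp [fibreDegree], by simp [fibreDegree, hε], fun v =>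
    congrArg (ε ^ fibreDegree a v.1 • ·) (chartPoint_coe z v)⟩).symm

theorem chartPoint_mem_stableLocus {ω : Fin (m + 1) → ℕ} (z : ChartVar k → ℂ) :
    chartPoint z ∈ stableLocus (weightedBundle ω a).irrelevantIdeal :=
  mem_stableLocus_weightedBundle.2 ⟨Or.inr (by simp), k, by simp⟩

theorem eval_dite_X (z : ChartVar k → ℂ) (v : BundleVar m) :
    eval z (if h : v ≠ Sum.inl 1 ∧ v ≠ Sum.inr k then X ⟨v, h⟩ else 1) = chartPoint z v := by
  by_cases h : v ≠ Sum.inl 1 ∧ v ≠ Sum.inr k <;> simp [chartPoint, h]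

end ChartPoint

section Normalization

theorem exists_eq_natCast_sub_natCast {D : Type*} (S : Finset D) (A : D → ℤ) :
    ∃ (M : ℕ) (p : D → ℕ), ∀ d ∈ S, A d = p d - M := by
  let M := ∑ d ∈ S, (A d).natAbs
  refine ⟨M, fun d => (A d + M).toNat, fun d hd => ?_⟩
  have hle : (A d).natAbs ≤ M :=
    Finset.single_le_sum (f := fun d => (A d).natAbs) (fun _ _ => Nat.zero_le _) hd
  lia

theorem prod_zpow_mul_pow_pow {M κ : Type*} [CommGroup M] [Fintype κ] (s t : M) (β : κ → ℤ)
    (φ e : κ → ℕ) : ∏ v, (s ^ β v * t ^ φ v) ^ e v = s ^ (∑ v, β v * e v) * t ^ ∑ v, φ v * e v := by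
  have zpow_sum : s ^ (∑ v, β v * e v) = ∏ v, s ^ (β v * e v) :=
    map_sum (zmultiplesHom (Additive M) (Additive.ofMul s)) (fun v => β v * e v) Finset.univ
  simp only [zpow_sum, mul_pow, Finset.prod_mul_distrib, ← pow_mul, zpow_mul, zpow_natCast,
    Finset.prod_pow_eq_pow_sum]

variable {m : ℕ} {ω a : Fin (m + 1) → ℕ} {k : Fin (m + 1)}

theorem exists_smul_eq_chartPoint_of_pow_eq {z : BundleVar m → ℂ} {x y t : ℂˣ}
    (hx : z (Sum.inl 1) = x) (hy : z (Sum.inr k) = y) (ht : t ^ a k = (x ^ ω k * y)⁻¹) :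
    (fun v => x⁻¹ ^ baseDegree ω v * t ^ fibreDegree a v) • z = chartPoint (k := k)
      fun v => ((x⁻¹ ^ baseDegree ω v.1 * t ^ fibreDegree a v.1 : ℂˣ) : ℂ) * z v.1 :=
  eq_chartPoint_iff.2 ⟨by simp [baseDegree, fibreDegree, Units.smul_def, hx], by
    simp [baseDegree, fibreDegree, Units.smul_def, hy, ht], fun _ => rfl⟩

theorem exists_pow_mul_pow_eq_prod {D : Type*} {S : Finset D} {e : D → ChartVar k → ℕ}
    (hS : ∀ d ∈ S, ∀ d' ∈ S,
      ∑ v, chartType a k v * e d v ≡ ∑ v, chartType a k v * e d' v [MOD a k]) :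
    ∃ p q : D → ℕ, ∀ x y t : ℂˣ, t ^ a k = (x ^ ω k * y)⁻¹ → ∃ u : ℂˣ, ∀ d ∈ S,
      ∏ v : ChartVar k, (x⁻¹ ^ baseDegree ω v.1 * t ^ fibreDegree a v.1) ^ e d v =
        u * (x ^ p d * y ^ q d) := by
  let B (d : D) : ℤ := ∑ v : ChartVar k, baseDegree ω v.1 * e d v
  let F (d : D) : ℕ := ∑ v, chartType a k v * e d v
  obtain ⟨j, hj⟩ : ∃ j, ∀ d ∈ S, F d % a k = j := by
    obtain rfl | ⟨d₀, hd₀⟩ := S.eq_empty_or_nonempty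
    · exact ⟨0, by simp⟩
    · exact ⟨F d₀ % a k, fun d hd => hS d hd d₀ hd₀⟩
  obtain ⟨M, p, hp⟩ := exists_eq_natCast_sub_natCast S fun d => -(B d + ω k * (F d / a k : ℕ))
  obtain ⟨N, q, hq⟩ := exists_eq_natCast_sub_natCast S fun d => -((F d / a k : ℕ) : ℤ)
  refine ⟨p, q, fun x y t ht => ⟨t ^ j * (x ^ M)⁻¹ * (y ^ N)⁻¹, fun d hd => ?_⟩⟩
  have pow_F : t ^ F d = t ^ j * ((x ^ ω k * y)⁻¹) ^ (F d / a k) := by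
    rw [← hj d hd, pow_eq_pow_mod_mul_pow_div ht]
  have pow_p : x⁻¹ ^ B d * ((x ^ ω k)⁻¹) ^ (F d / a k) = (x ^ M)⁻¹ * x ^ p d := by
    rw [← zpow_natCast x (p d), ← zpow_natCast x M, ← zpow_neg, ← zpow_add,
      show -(M : ℤ) + p d = -(B d + ω k * (F d / a k : ℕ)) by rw [hp d hd]; ring, zpow_neg,
      zpow_add, mul_inv, inv_zpow, zpow_mul, inv_pow, zpow_natCast, zpow_natCast]
  have pow_q : (y⁻¹) ^ (F d / a k) = (y ^ N)⁻¹ * y ^ q d := by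
    rw [← zpow_natCast y (q d), ← zpow_natCast y N, ← zpow_neg, ← zpow_add,
      show -(N : ℤ) + q d = -((F d / a k : ℕ) : ℤ) by rw [hq d hd]; ring, zpow_neg, inv_pow,
      zpow_natCast]
  calc ∏ v : ChartVar k, (x⁻¹ ^ baseDegree ω v.1 * t ^ fibreDegree a v.1) ^ e d v
      = x⁻¹ ^ B d * t ^ F d := prod_zpow_mul_pow_pow _ _ _ _ _
    _ = t ^ j * (x⁻¹ ^ B d * ((x ^ ω k)⁻¹) ^ (F d / a k)) * (y⁻¹) ^ (F d / a k) := by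
      rw [pow_F, mul_inv, mul_pow, mul_left_comm, mul_assoc, mul_assoc]
    _ = t ^ j * (x ^ M)⁻¹ * (y ^ N)⁻¹ * (x ^ p d * y ^ q d) := by
      rw [pow_p, pow_q]
      ac_rfl

/-- The condition on the exponents is that `μ_{a_k}` acts with one weight on the monomials
`w ^ e d`. -/
theorem exists_monomials_eq_mul_eval (hak : 0 < a k) {D : Type*} {S : Finset D}
    {e : D → ChartVar k → ℕ} (hS : ∀ d ∈ S, ∀ d' ∈ S,
      ∑ v, chartType a k v * e d v ≡ ∑ v, chartType a k v * e d' v [MOD a k]) :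
    ∃ E : D → MvPolynomial (BundleVar m) ℂ, ∀ z : BundleVar m → ℂ, z (Sum.inl 1) ≠ 0 →
      z (Sum.inr k) ≠ 0 → ∃ g ∈ (weightedBundle ω a).group, ∃ w : ChartVar k → ℂ,
        g • z = chartPoint w ∧ ∃ μ : ℂ, μ ≠ 0 ∧ ∀ d ∈ S, ∏ v, w v ^ e d v = μ * eval z (E d) := by
  obtain ⟨p, q, hpq⟩ := exists_pow_mul_pow_eq_prod (ω := ω) hS
  refine ⟨fun d => X (Sum.inl 1) ^ p d * X (Sum.inr k) ^ q d * ∏ v : ChartVar k, X v.1 ^ e d v,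
    fun z hx hy => ?_⟩
  obtain ⟨t, ht⟩ := exists_units_pow_eq hak (Units.mk0 _ hx ^ ω k * Units.mk0 _ hy)⁻¹
  obtain ⟨u, hu⟩ := hpq _ _ t ht
  refine ⟨_, mem_group_weightedBundle.2 ⟨_, t, fun _ => rfl⟩, _,
    exists_smul_eq_chartPoint_of_pow_eq rfl rfl ht, u, u.ne_zero, fun d hd => ?_⟩
  simp_rw [mul_pow _ (z _), Finset.prod_mul_distrib, ← Units.val_pow_eq_pow_val, ← Units.coe_prod,
    hu d hd]
  simp [mul_assoc]

theorem exists_smul_eq_chartPoint (hak : 0 < a k) {z : BundleVar m → ℂ} (h1 : z (Sum.inl 1) ≠ 0)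
    (hk : z (Sum.inr k) ≠ 0) :
    ∃ g ∈ (weightedBundle ω a).group, ∃ w : ChartVar k → ℂ, g • z = chartPoint w :=
  have ⟨_, ht⟩ := exists_units_pow_eq hak (Units.mk0 _ h1 ^ ω k * Units.mk0 _ hk)⁻¹
  ⟨_, mem_group_weightedBundle.2 ⟨_, _, fun _ => rfl⟩, _,
    exists_smul_eq_chartPoint_of_pow_eq rfl rfl ht⟩

end Normalization

section Chart

variable {m : ℕ} {ω a : Fin (m + 1) → ℕ} {k : Fin (m + 1)}

theorem pow_fibreDegree_mem_group (u : ℂˣ) :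
    (fun v => u ^ fibreDegree a v) ∈ (weightedBundle ω a).group :=
  mem_group_weightedBundle.2 ⟨1, u, by simp⟩

theorem exists_root_of_mem_group {g : BundleVar m → ℂˣ} (hg : g ∈ (weightedBundle ω a).group)
    (h1 : g (Sum.inl 1) = 1) (hk : g (Sum.inr k) = 1) :
    ∃ ε : ℂˣ, ε ^ a k = 1 ∧ g = fun v => ε ^ fibreDegree a v := by
  obtain ⟨s, ε, hsε⟩ := mem_group_weightedBundle.1 hg
  obtain rfl : s = 1 := by simpa [baseDegree, fibreDegree, h1] using (hsε (Sum.inl 1)).symm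
  simp only [one_zpow, one_mul] at hsε
  exact ⟨ε, by rw [← hk, hsε]; rfl, funext hsε⟩

variable (ω a k) in
/-- The chart `ℂ^{m+1} / μ_{a_k} → 𝓕` given by `x_1 = y_k = 1`. -/
noncomputable def chart :
    cyclicQuotient (a k) (chartType a k) → (weightedBundle ω a).variety :=
  quotientSpace.lift
    (fun z _ => quotientSpace.mk (chartPoint z) (chartPoint_mem_stableLocus z)) <| by
    rintro z - t ⟨ε, hε, ht⟩ -
    obtain rfl : t = fun v => ε ^ chartType a k v := funext ht
    exact (quotientSpace.mk_eq_mk.2 ⟨_, pow_fibreDegree_mem_group ε, chartPoint_smul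
      ((mem_rootsOfUnity _ _).1 hε) z⟩).symm

theorem chart_mk (z : ChartVar k → ℂ) (hz : z ∈ stableLocus ⊤) :
    chart ω a k (quotientSpace.mk z hz) =
      quotientSpace.mk (chartPoint z) (chartPoint_mem_stableLocus z) :=
  rfl

theorem mk_mem_range_chart_iff (hak : 0 < a k) {z : BundleVar m → ℂ}
    {hz : z ∈ stableLocus (weightedBundle ω a).irrelevantIdeal} :
    quotientSpace.mk z hz ∈ Set.range (chart ω a k) ↔ z (Sum.inl 1) ≠ 0 ∧ z (Sum.inr k) ≠ 0 := by
  constructor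
  · rintro ⟨x, hx⟩
    induction x using quotientSpace.ind with
    | h w hw =>
      obtain ⟨t, -, rfl⟩ := quotientSpace.mk_eq_mk.1 hx
      simp [Units.smul_def]
  · rintro ⟨h1, hk⟩
    obtain ⟨g, hg, w, hw⟩ := exists_smul_eq_chartPoint (ω := ω) hak h1 hk
    exact ⟨cyclicQuotient.mk w, (quotientSpace.mk_eq_mk.2 ⟨g, hg, hw.symm⟩).symm⟩

theorem chart_injective : Function.Injective (chart ω a k) := by
  intro x y hxy
  induction x using quotientSpace.ind with
  | h z hz =>
    induction y using quotientSpace.ind with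
    | h w hw =>
      obtain ⟨g, hg, hgz⟩ := quotientSpace.mk_eq_mk.1 hxy
      have h1 : g (Sum.inl 1) = 1 := by simpa [Units.smul_def] using congrFun hgz.symm (Sum.inl 1)
      have hk : g (Sum.inr k) = 1 := by simpa [Units.smul_def] using congrFun hgz.symm (Sum.inr k)
      obtain ⟨ε, hε, rfl⟩ := exists_root_of_mem_group hg h1 hk
      rw [← chartPoint_smul hε] at hgz
      refine quotientSpace.mk_eq_mk.2 ⟨_, ⟨ε, hε, fun _ => rfl⟩, funext fun v => ?_⟩
      rw [← chartPoint_coe w, hgz, chartPoint_coe]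

theorem isMorphism_chart : IsMorphism (chart ω a k) :=
  isMorphism_of_polynomial isTorusInvariant_weightedBundle
    (fun v => if h : v ≠ Sum.inl 1 ∧ v ≠ Sum.inr k then X ⟨v, h⟩ else 1) fun z hz => by
      simp only [eval_dite_X]
      exact ⟨chartPoint_mem_stableLocus z, chart_mk z hz⟩

theorem isOpenImmersionOn_chart (hak : 0 < a k) : IsOpenImmersionOn (chart ω a k) Set.univ := by
  refine isOpenImmersionOn_of_isLocallyPolynomial isTorusInvariant_top isMorphism_chart isOpen_univ
    chart_injective.injOn fun S hS w hw w' hw' ⟨_, hww'⟩ _ => ?_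
  obtain ⟨E, hE⟩ := exists_monomials_eq_mul_eval (ω := ω) hak fun d hd d' hd' =>
    hS.modEq hak.ne' (fun ε hε => ⟨ε, hε, fun _ => rfl⟩) hd hd'
  refine ⟨X (Sum.inl 1) * X (Sum.inr k), E, ?_, fun z hz hN => ?_⟩
  · simpa using (mk_mem_range_chart_iff hak).1 ⟨_, hww'⟩
  · rw [map_mul, eval_X, eval_X] at hN
    obtain ⟨g, hg, v, hv, hμ⟩ := hE z (left_ne_zero_of_mul hN) (right_ne_zero_of_mul hN)
    exact ⟨v, by simp [stableLocus, zeroLocus_top], ⟨trivial,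
      (quotientSpace.mk_eq_mk.2 ⟨g, hg, hv.symm⟩).symm⟩, hμ⟩

end Chart

/-! ### The blow up morphism -/

section BlowDown

variable {m : ℕ} {ω a b : Fin (m + 1) → ℕ} {k : Fin (m + 1)}

section BlowDownPoint

/-- The homogeneous coordinates `(X_0 ζ^{b_k} : X_1; … : Y_i ζ^{b_i} : … : Y_k : …)`, where `ζ`
stands for `ξ^{1/a_k}`. -/
def blowDownPoint (k : Fin (m + 1)) (b : Fin (m + 1) → ℕ) (z : BlowUpVar m → ℂ) (ζ : ℂ) :
    BundleVar m → ℂ :=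
  fun v => ζ ^ blowUpWeight k b v * z (some v)

theorem blowDownPoint_mem_stableLocus (hak : a k ≠ 0) {z : BlowUpVar m → ℂ}
    (hz : z ∈ stableLocus (rankThreeStack ω a k b).irrelevantIdeal) {ζ : ℂ}
    (hζ : ζ ^ a k = z none) :
    blowDownPoint k b z ζ ∈ stableLocus (weightedBundle ω a).irrelevantIdeal := by
  obtain ⟨bundle, center, -⟩ := mem_stableLocus_rankThreeStack.1 hz
  rw [mem_stableLocus_weightedBundle] at bundle ⊢
  obtain rfl | hζ0 := eq_or_ne ζ 0
  · obtain ⟨h1, hk⟩ := center (by rw [← hζ, zero_pow hak])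
    exact ⟨Or.inr (by simpa [blowDownPoint, blowUpWeight] using h1), k,
      by simpa [blowDownPoint, blowUpWeight] using hk⟩
  · simpa [blowDownPoint, hζ0] using bundle

theorem pow_blowUpWeight_mem_group (hbw : ∀ v, blowUpWeight k b v ≡ fibreDegree a v [MOD a k])
    {ε : ℂˣ} (hε : ε ^ a k = 1) :
    (fun v => ε ^ blowUpWeight k b v) ∈ (weightedBundle ω a).group := by
  have pow_eq v : ε ^ blowUpWeight k b v = ε ^ fibreDegree a v := pow_eq_pow_of_modEq (hbw v) hε
  simpa only [pow_eq] using pow_fibreDegree_mem_group ε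

theorem exists_blowDownPoint_smul (hak : a k ≠ 0)
    (hbw : ∀ v, blowUpWeight k b v ≡ fibreDegree a v [MOD a k]) {t : BlowUpVar m → ℂˣ}
    (ht : t ∈ (rankThreeStack ω a k b).group) {z : BlowUpVar m → ℂ} {ζ ζ' : ℂ}
    (hζ : ζ ^ a k = z none) (hζ' : ζ' ^ a k = (t • z) none) :
    ∃ g ∈ (weightedBundle ω a).group,
      blowDownPoint k b (t • z) ζ' = g • blowDownPoint k b z ζ := by
  obtain ⟨g, hg, u, t_some, t_none⟩ := mem_group_rankThreeStack.1 ht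
  obtain ⟨ε, hε, rfl⟩ : ∃ ε : ℂˣ, ε ^ a k = 1 ∧ ζ' = ε * ((u⁻¹ : ℂˣ) * ζ) :=
    exists_units_mul_eq_of_pow_eq_pow hak <| by
      simp [hζ', hζ, mul_pow, t_none, Units.smul_def]
  refine ⟨_, mul_mem (pow_blowUpWeight_mem_group hbw hε) hg, funext fun v => ?_⟩
  have hu := pow_ne_zero (blowUpWeight k b v) u.ne_zero
  simp only [blowDownPoint, Pi.smul_apply', Units.smul_def, smul_eq_mul, t_some, mul_pow,
    Pi.mul_apply, Units.val_mul, Units.val_pow_eq_pow_val, Units.val_inv_eq_inv_val, inv_pow]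
  field_simp

theorem exists_eq_smul_of_blowDownPoint_eq_smul {z w : BlowUpVar m → ℂ} {ζ ξ : ℂ}
    (hζ : ζ ^ a k = z none) (hξ : ξ ^ a k = w none) (hζ0 : ζ ≠ 0) (hξ0 : ξ ≠ 0)
    {g : BundleVar m → ℂˣ} (hg : g ∈ (weightedBundle ω a).group)
    (h : blowDownPoint k b w ξ = g • blowDownPoint k b z ζ) :
    ∃ t ∈ (rankThreeStack ω a k b).group, w = t • z := by
  let u : ℂˣ := Units.mk0 ζ hζ0 / Units.mk0 ξ hξ0
  refine ⟨fun i => i.elim (u ^ a k)⁻¹ fun v => g v * u ^ blowUpWeight k b v,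
    mem_group_rankThreeStack.2 ⟨g, hg, u, fun _ => rfl, rfl⟩, funext fun i => ?_⟩
  cases i with
  | none => simp [u, ← hζ, ← hξ, Units.smul_def, hζ0, div_pow]
  | some v =>
    have hv : ξ ^ blowUpWeight k b v * w (some v) = g v * (ζ ^ blowUpWeight k b v * z (some v)) :=
      congrFun h v
    simp only [u, Pi.smul_apply', Option.elim_some, Units.smul_def, smul_eq_mul, Units.val_mul,
      Units.val_pow_eq_pow_val, Units.val_div_eq_div_val, Units.val_mk0, div_pow]
    field_simp
    linear_combination hv

theorem prod_blowDownPoint_pow {z : BlowUpVar m → ℂ} {ζ : ℂ} (hζ : ζ ^ a k = z none)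
    (d : BundleVar m → ℕ) :
    ∏ v, blowDownPoint k b z ζ v ^ d v = ζ ^ ((∑ v, blowUpWeight k b v * d v) % a k) *
      (z none ^ ((∑ v, blowUpWeight k b v * d v) / a k) * ∏ v, z (some v) ^ d v) := by
  simp only [blowDownPoint, mul_pow, Finset.prod_mul_distrib, ← pow_mul,
    Finset.prod_pow_eq_pow_sum]
  rw [pow_eq_pow_mod_mul_pow_div hζ, mul_assoc]

theorem exists_smul_eq_basePoint (hak : 0 < a k) {z : BundleVar m → ℂ} (h1 : z (Sum.inl 1) ≠ 0)
    (hk : z (Sum.inr k) ≠ 0) (hz : ∀ v : ChartVar k, z v.1 = 0) :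
    ∃ g ∈ (weightedBundle ω a).group, g • z = basePoint k := by
  obtain ⟨g, hg, w, hw⟩ := exists_smul_eq_chartPoint (ω := ω) hak h1 hk
  obtain rfl : w = 0 := funext fun v => by
    rw [← chartPoint_coe w, ← hw, Pi.smul_apply', hz, smul_zero, Pi.zero_apply]
  exact ⟨g, hg, hw.trans basePoint_eq_chartPoint_zero.symm⟩

end BlowDownPoint

theorem basePoint_mem_stableLocus :
    basePoint k ∈ stableLocus (weightedBundle ω a).irrelevantIdeal :=
  basePoint_eq_chartPoint_zero (k := k) ▸ chartPoint_mem_stableLocus 0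

/-- The blow up morphism from the coarse moduli space of `T` to `𝓕`. -/
noncomputable def blowDown (hak : a k ≠ 0)
    (hbw : ∀ v, blowUpWeight k b v ≡ fibreDegree a v [MOD a k]) :
    (rankThreeStack ω a k b).variety → (weightedBundle ω a).variety :=
  quotientSpace.lift
    (fun z hz => quotientSpace.mk (blowDownPoint k b z (z none ^ (a k : ℂ)⁻¹))
      (blowDownPoint_mem_stableLocus hak hz (Complex.cpow_nat_inv_pow _ hak)))
    fun _ _ _ ht _ => .symm <| quotientSpace.mk_eq_mk.2 <|
      exists_blowDownPoint_smul hak hbw ht (Complex.cpow_nat_inv_pow _ hak)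
        (Complex.cpow_nat_inv_pow _ hak)

variable {hak : a k ≠ 0} {hbw : ∀ v, blowUpWeight k b v ≡ fibreDegree a v [MOD a k]}

theorem blowDown_mk {z : BlowUpVar m → ℂ}
    (hz : z ∈ stableLocus (rankThreeStack ω a k b).irrelevantIdeal) {ζ : ℂ}
    (hζ : ζ ^ a k = z none) :
    blowDown hak hbw (quotientSpace.mk z hz) =
      quotientSpace.mk (blowDownPoint k b z ζ) (blowDownPoint_mem_stableLocus hak hz hζ) := by
  refine quotientSpace.mk_eq_mk.2 ?_
  simpa only [one_smul] using exists_blowDownPoint_smul hak hbw (one_mem _)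
    (Complex.cpow_nat_inv_pow _ hak) (by rwa [one_smul])

theorem blowDown_mk_eq_basePoint_iff (hb : ∀ i, 0 < b i) {z : BlowUpVar m → ℂ}
    (hz : z ∈ stableLocus (rankThreeStack ω a k b).irrelevantIdeal) :
    blowDown hak hbw (quotientSpace.mk z hz) =
      quotientSpace.mk (basePoint k) basePoint_mem_stableLocus ↔ z none = 0 := by
  have weight_ne_zero (v : ChartVar k) := (blowUpWeight_ne_zero_iff hb).2 v.2
  obtain ⟨ζ, hζ⟩ := IsAlgClosed.exists_pow_nat_eq (z none) (Nat.pos_of_ne_zero hak)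
  rw [blowDown_mk hz hζ, ← hζ, pow_eq_zero_iff hak]
  constructor
  · intro h
    obtain ⟨t, -, ht⟩ := quotientSpace.mk_eq_mk.1 h
    obtain ⟨v, hv⟩ := (mem_stableLocus_rankThreeStack.1 hz).2.2
    have := congrFun ht v.1
    rw [basePoint_eq_chartPoint_zero, chartPoint_coe] at this
    simpa [blowDownPoint, Units.smul_def, hv, weight_ne_zero] using this.symm
  · rintro rfl
    obtain ⟨h1, hk⟩ := (mem_stableLocus_rankThreeStack.1 hz).2.1 (by rw [← hζ, zero_pow hak])
    refine quotientSpace.mk_eq_mk.2 ?_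
    obtain ⟨g, hg, h⟩ := exists_smul_eq_basePoint (ω := ω) (z := blowDownPoint k b z 0)
      (Nat.pos_of_ne_zero hak) (by simpa [blowDownPoint, blowUpWeight] using h1)
      (by simpa [blowDownPoint, blowUpWeight] using hk)
      fun v => by simp [blowDownPoint, weight_ne_zero]
    exact ⟨g, hg, h.symm⟩

theorem mk_mem_blowDown_preimage_compl_iff (hb : ∀ i, 0 < b i) {z : BlowUpVar m → ℂ}
    {hz : z ∈ stableLocus (rankThreeStack ω a k b).irrelevantIdeal} :
    quotientSpace.mk z hz ∈ blowDown hak hbw ⁻¹'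
      {quotientSpace.mk (basePoint k) basePoint_mem_stableLocus}ᶜ ↔ z none ≠ 0 :=
  not_congr (blowDown_mk_eq_basePoint_iff hb hz)

theorem isMorphism_blowDown : IsMorphism (blowDown (ω := ω) hak hbw) := by
  refine isMorphism_of_isLocallyPolynomial isTorusInvariant_weightedBundle ?_
  rintro S hS w _ w' hw' hww' ⟨d₀, hd₀, hne⟩
  let F (d : BundleVar m →₀ ℕ) : ℕ := ∑ v, blowUpWeight k b v * d v
  have mod_eq d (hd : d ∈ S) : F d % a k = F d₀ % a k :=
    hS.modEq hak (fun _ => pow_blowUpWeight_mem_group hbw) hd hd₀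
  refine ⟨X none ^ (F d₀ % a k),
    fun d => X none ^ (F d / a k) * ∏ v, X (some v) ^ d v, ?_, fun z hz hN => ?_⟩
  · obtain ⟨ζ, hζ⟩ := IsAlgClosed.exists_pow_nat_eq (w' none) (Nat.pos_of_ne_zero hak)
    obtain ⟨t, -, rfl⟩ := quotientSpace.mk_eq_mk.1 ((blowDown_mk hw' hζ).symm.trans hww')
    simp only [Pi.smul_apply', Units.smul_def, smul_eq_mul, mul_pow, Finset.prod_mul_distrib,
      prod_blowDownPoint_pow hζ] at hne
    rw [map_pow, eval_X, ← hζ, pow_right_comm]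
    exact pow_ne_zero _ (left_ne_zero_of_mul (right_ne_zero_of_mul hne))
  · obtain ⟨ζ, hζ⟩ := IsAlgClosed.exists_pow_nat_eq (z none) (Nat.pos_of_ne_zero hak)
    refine ⟨_, _, blowDown_mk hz hζ, ζ ^ (F d₀ % a k), ?_, fun d hd => ?_⟩
    · rw [map_pow, eval_X, ← hζ, pow_right_comm] at hN
      exact (pow_ne_zero_iff hak).1 hN
    · rw [prod_blowDownPoint_pow hζ, ← mod_eq d hd]
      simp [F]

theorem injOn_blowDown (hb : ∀ i, 0 < b i) : Set.InjOn (blowDown (ω := ω) hak hbw)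
    (blowDown hak hbw ⁻¹' {quotientSpace.mk (basePoint k) basePoint_mem_stableLocus}ᶜ) := by
  intro x hx y hy hxy
  induction x using quotientSpace.ind with
  | h z hz =>
    induction y using quotientSpace.ind with
    | h w hw =>
      rw [mk_mem_blowDown_preimage_compl_iff hb] at hx hy
      obtain ⟨ζ, hζ⟩ := IsAlgClosed.exists_pow_nat_eq (z none) (Nat.pos_of_ne_zero hak)
      obtain ⟨ξ, hξ⟩ := IsAlgClosed.exists_pow_nat_eq (w none) (Nat.pos_of_ne_zero hak)
      rw [← hζ, pow_ne_zero_iff hak] at hx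
      rw [← hξ, pow_ne_zero_iff hak] at hy
      rw [blowDown_mk hz hζ, blowDown_mk hw hξ] at hxy
      obtain ⟨g, hg, h⟩ := quotientSpace.mk_eq_mk.1 hxy
      exact quotientSpace.mk_eq_mk.2 (exists_eq_smul_of_blowDownPoint_eq_smul hζ hξ hx hy hg h)

theorem elim_one_mem_stableLocus {z : BundleVar m → ℂ}
    (hz : z ∈ stableLocus (weightedBundle ω a).irrelevantIdeal) (hv : ∃ v : ChartVar k, z v.1 ≠ 0) :
    (fun i => i.elim 1 z : BlowUpVar m → ℂ) ∈
      stableLocus (rankThreeStack ω a k b).irrelevantIdeal :=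
  mem_stableLocus_rankThreeStack.2 ⟨hz, fun h => (one_ne_zero h).elim, hv⟩

theorem blowDown_mk_elim_one {z : BundleVar m → ℂ}
    (hz : z ∈ stableLocus (weightedBundle ω a).irrelevantIdeal)
    (hz' : (fun i => i.elim 1 z : BlowUpVar m → ℂ) ∈
      stableLocus (rankThreeStack ω a k b).irrelevantIdeal) :
    blowDown hak hbw (quotientSpace.mk _ hz') = quotientSpace.mk z hz := by
  refine (blowDown_mk hz' (one_pow (a k))).trans ?_
  exact quotientSpace.mk_eq_mk.2 ⟨1, one_mem _, funext fun v => by simp [blowDownPoint]⟩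

theorem isOpenImmersionOn_blowDown (hb : ∀ i, 0 < b i) :
    IsOpenImmersionOn (blowDown (ω := ω) hak hbw)
      (blowDown hak hbw ⁻¹' {quotientSpace.mk (basePoint k) basePoint_mem_stableLocus}ᶜ) := by
  refine isOpenImmersionOn_of_isLocallyPolynomial isTorusInvariant_rankThreeStack
    isMorphism_blowDown ?_ (injOn_blowDown hb) fun S _ w hw w' hw' ⟨hwW, hww'⟩ _ => ?_
  · refine quotientSpace.isOpen_iff.2 fun z hz hzW => ⟨X none, ?_, fun y hy hyW => ?_⟩
    · simpa using (mk_mem_blowDown_preimage_compl_iff hb).1 hzW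
    · exact (mk_mem_blowDown_preimage_compl_iff hb).2 (by simpa using hyW)
  · obtain ⟨ζ, hζ⟩ := IsAlgClosed.exists_pow_nat_eq (w none) (Nat.pos_of_ne_zero hak)
    have hζ0 : ζ ≠ 0 := by
      rwa [mk_mem_blowDown_preimage_compl_iff hb, ← hζ, pow_ne_zero_iff hak] at hwW
    obtain ⟨t, -, rfl⟩ := quotientSpace.mk_eq_mk.1 ((blowDown_mk hw hζ).symm.trans hww')
    obtain ⟨v, hv⟩ := (mem_stableLocus_rankThreeStack.1 hw).2.2
    refine ⟨X v.1, fun d => ∏ i : BlowUpVar m, (i.elim 1 X) ^ d i, ?_, fun z hz hzv => ?_⟩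
    · simp [blowDownPoint, Units.smul_def, hζ0, hv]
    · have hz' := elim_one_mem_stableLocus (k := k) (b := b) hz ⟨v, by simpa using hzv⟩
      refine ⟨_, hz', ⟨(mk_mem_blowDown_preimage_compl_iff hb).2 one_ne_zero,
        blowDown_mk_elim_one hz hz'⟩, 1, one_ne_zero, fun d _ => ?_⟩
      rw [one_mul, map_prod]
      refine Finset.prod_congr rfl fun i _ => ?_
      cases i <;> simp

theorem exists_mem_stableLocus_none_eq_zero :
    ∃ z ∈ stableLocus (rankThreeStack ω a k b).irrelevantIdeal, z none = 0 :=
  ⟨fun i => i.elim 0 (Sum.elim 1 (Pi.single k 1)), mem_stableLocus_rankThreeStack.2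
    ⟨mem_stableLocus_weightedBundle.2 ⟨by simp, k, by simp⟩, by simp, ⟨Sum.inl 0, by simp⟩,
      by simp⟩, rfl⟩

theorem blowDown_surjective (hb : ∀ i, 0 < b i) :
    Function.Surjective (blowDown (ω := ω) hak hbw) := by
  intro y
  induction y using quotientSpace.ind with
  | h z hz =>
    by_cases hv : ∃ v : ChartVar k, z v.1 ≠ 0
    · exact ⟨_, blowDown_mk_elim_one hz (elim_one_mem_stableLocus hz hv)⟩
    · push Not at hv
      obtain ⟨w, hw, hw0⟩ := exists_mem_stableLocus_none_eq_zero (ω := ω) (a := a) (k := k) (b := b)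
      refine ⟨quotientSpace.mk w hw, ((blowDown_mk_eq_basePoint_iff hb hw).2 hw0).trans ?_⟩
      obtain ⟨h01, i, hi⟩ := mem_stableLocus_weightedBundle.1 hz
      have h1 : z (Sum.inl 1) ≠ 0 := h01.resolve_left (not_not.2 (hv ⟨Sum.inl 0, by simp⟩))
      obtain rfl : i = k := by
        by_contra hik
        exact hi (hv ⟨Sum.inr i, by simpa using hik⟩)
      exact (quotientSpace.mk_eq_mk.2 (by
        obtain ⟨g, hg, h⟩ := exists_smul_eq_basePoint (ω := ω) (Nat.pos_of_ne_zero hak) h1 hi hv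
        exact ⟨g, hg, h.symm⟩)).symm

end BlowDown

section LiftedChart

variable {m : ℕ} {ω a b : Fin (m + 1) → ℕ} {k : Fin (m + 1)}

section LiftedChartPoint

/-- The point of `T` with `X_1 = Y_k = 1`, `ξ = u^r` and the other coordinates given by `z`, where
`(z, u)` are the coordinates on the weighted blow up of the chart. -/
def liftedChartPoint (r : ℕ) (z : Option (ChartVar k) → ℂ) : BlowUpVar m → ℂ :=
  fun i => i.elim (z none ^ r) (chartPoint fun v => z (some v))

theorem liftedChartPoint_mem_stableLocus {r : ℕ} {z : Option (ChartVar k) → ℂ}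
    (hz : ∃ v, z (some v) ≠ 0) :
    liftedChartPoint r z ∈ stableLocus (rankThreeStack ω a k b).irrelevantIdeal :=
  mem_stableLocus_rankThreeStack.2 ⟨chartPoint_mem_stableLocus fun v => z (some v),
    fun _ => by simp [liftedChartPoint], by simpa [liftedChartPoint] using hz⟩

theorem exists_liftedChartPoint_smul {s : Option (ChartVar k) → ℂˣ}
    (hs : s ∈ weightedBlowUpGroup (a k) (chartType a k) fun v => blowUpWeight k b v.1)
    (z : Option (ChartVar k) → ℂ) :
    ∃ t ∈ (rankThreeStack ω a k b).group,
      liftedChartPoint (a k) (s • z) = t • liftedChartPoint (a k) z := by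
  obtain ⟨t, ε, hε, s_some, s_none⟩ := hs
  have chart_smul : chartPoint (fun v => (s • z) (some v)) =
      (fun v => ε ^ fibreDegree a v * t ^ blowUpWeight k b v) •
        chartPoint fun v => z (some v) := by
    refine (eq_chartPoint_iff.2 ⟨?_, ?_, fun v => ?_⟩).symm
    · simp [fibreDegree, blowUpWeight]
    · simp [fibreDegree, blowUpWeight, (mem_rootsOfUnity _ _).1 hε]
    · rw [Pi.smul_apply', chartPoint_coe, Pi.smul_apply', s_some, mul_comm (t ^ _)]
      rfl
  refine ⟨fun i => i.elim (t ^ a k)⁻¹ fun v => ε ^ fibreDegree a v * t ^ blowUpWeight k b v,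
    mem_group_rankThreeStack.2 ⟨_, pow_fibreDegree_mem_group ε, t, fun _ => rfl, rfl⟩,
    funext fun i => ?_⟩
  cases i with
  | none => simp [liftedChartPoint, Units.smul_def, s_none, mul_pow]
  | some v => exact congrFun chart_smul v

theorem exists_eq_smul_of_liftedChartPoint_eq_smul (hak : a k ≠ 0)
    (hbw : ∀ v, blowUpWeight k b v ≡ fibreDegree a v [MOD a k]) {z w : Option (ChartVar k) → ℂ}
    {t : BlowUpVar m → ℂˣ} (ht : t ∈ (rankThreeStack ω a k b).group)
    (h : liftedChartPoint (a k) w = t • liftedChartPoint (a k) z) :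
    ∃ s ∈ weightedBlowUpGroup (a k) (chartType a k) fun v => blowUpWeight k b v.1, w = s • z := by
  obtain ⟨g, hg, u, t_some, t_none⟩ := mem_group_rankThreeStack.1 ht
  have h1 : g (Sum.inl 1) = 1 := by
    simpa [liftedChartPoint, Units.smul_def, t_some, blowUpWeight] using
      (congrFun h (some (Sum.inl 1))).symm
  have hk : g (Sum.inr k) = 1 := by
    simpa [liftedChartPoint, Units.smul_def, t_some, blowUpWeight] using
      (congrFun h (some (Sum.inr k))).symm
  obtain ⟨ε, hε, rfl⟩ := exists_root_of_mem_group hg h1 hk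
  obtain ⟨η, hη, w_none⟩ : ∃ η : ℂˣ, η ^ a k = 1 ∧ w none = η * ((u⁻¹ : ℂˣ) * z none) :=
    exists_units_mul_eq_of_pow_eq_pow hak <| (congrFun h none).trans <| by
      simp [liftedChartPoint, Units.smul_def, t_none, mul_pow]
  have root_pow (v : ChartVar k) : η ^ blowUpWeight k b v.1 = η ^ chartType a k v :=
    pow_eq_pow_of_modEq (hbw v.1) hη
  refine ⟨fun i => i.elim (η * u⁻¹) fun v => t (some v.1), ⟨u * η⁻¹, ε * η,
    mul_mem hε hη, fun v => ?_, by simp⟩, funext fun i => ?_⟩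
  · simp only [Option.elim_some, t_some, mul_pow, inv_pow, root_pow]
    rw [mul_mul_mul_comm, mul_comm (u ^ _), mul_assoc, mul_comm _ (η ^ _), mul_inv_cancel, mul_one]
    rfl
  · cases i with
    | none => simp [w_none, Units.smul_def, mul_assoc]
    | some v => simpa [liftedChartPoint] using congrFun h (some v.1)

end LiftedChartPoint

variable (ω a b k) in
/-- The chart of `T` that lies over `chart ω a k`. -/
noncomputable def liftedChart :
    weightedBlowUp (a k) (chartType a k) (fun v : ChartVar k => blowUpWeight k b v.1) →
      (rankThreeStack ω a k b).variety :=
  quotientSpace.lift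
    (fun z hz => quotientSpace.mk (liftedChartPoint (a k) z)
      (liftedChartPoint_mem_stableLocus (mem_stableLocus_span_X_some.1 hz)))
    fun z _ _ hs _ => .symm <| quotientSpace.mk_eq_mk.2 <| exists_liftedChartPoint_smul hs z

theorem exists_liftedChart_mk_eq {z : BlowUpVar m → ℂ}
    (hz : z ∈ stableLocus (rankThreeStack ω a k b).irrelevantIdeal) {g : BundleVar m → ℂˣ}
    (hg : g ∈ (weightedBundle ω a).group) {w : ChartVar k → ℂ}
    (hw : (g • fun v => z (some v)) = chartPoint w) {u : ℂ} (hu : u ^ a k = z none) :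
    ∃ h, liftedChart ω a b k (quotientSpace.mk (fun i => i.elim u w) h) =
      quotientSpace.mk z hz := by
  obtain ⟨v, hv⟩ := (mem_stableLocus_rankThreeStack.1 hz).2.2
  have hwv : w v ≠ 0 := by
    rw [← chartPoint_coe w, ← hw]
    simpa [Units.smul_def] using hv
  refine ⟨mem_stableLocus_span_X_some.2 ⟨v, hwv⟩, .symm <| quotientSpace.mk_eq_mk.2
    ⟨fun i => i.elim 1 g, mem_group_rankThreeStack.2 ⟨g, hg, 1, by simp, by simp⟩,
      funext fun i => ?_⟩⟩
  cases i with
  | none => simp [liftedChartPoint, hu]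
  | some v => exact (congrFun hw v).symm

theorem mk_mem_range_liftedChart_iff (hak : 0 < a k) {z : BlowUpVar m → ℂ}
    {hz : z ∈ stableLocus (rankThreeStack ω a k b).irrelevantIdeal} :
    quotientSpace.mk z hz ∈ Set.range (liftedChart ω a b k) ↔
      z (some (Sum.inl 1)) ≠ 0 ∧ z (some (Sum.inr k)) ≠ 0 := by
  constructor
  · rintro ⟨x, hx⟩
    induction x using quotientSpace.ind with
    | h w hw =>
      obtain ⟨t, -, rfl⟩ := quotientSpace.mk_eq_mk.1 hx
      simp [liftedChartPoint, Units.smul_def]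
  · rintro ⟨h1, hk⟩
    obtain ⟨g, hg, w, hw⟩ := exists_smul_eq_chartPoint (ω := ω) (z := fun v => z (some v)) hak h1 hk
    obtain ⟨u, hu⟩ := IsAlgClosed.exists_pow_nat_eq (z none) hak
    exact ⟨_, (exists_liftedChart_mk_eq hz hg hw hu).2⟩

theorem liftedChart_injective (hak : a k ≠ 0)
    (hbw : ∀ v, blowUpWeight k b v ≡ fibreDegree a v [MOD a k]) :
    Function.Injective (liftedChart ω a b k) := by
  intro x y hxy
  induction x using quotientSpace.ind with
  | h z hz =>
    induction y using quotientSpace.ind with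
    | h w hw =>
      obtain ⟨t, ht, h⟩ := quotientSpace.mk_eq_mk.1 hxy
      exact quotientSpace.mk_eq_mk.2 (exists_eq_smul_of_liftedChartPoint_eq_smul hak hbw ht h)

theorem isMorphism_liftedChart : IsMorphism (liftedChart ω a b k) :=
  isMorphism_of_polynomial isTorusInvariant_rankThreeStack
    (fun i => i.elim (X none ^ a k) fun v => rename some
      (if h : v ≠ Sum.inl 1 ∧ v ≠ Sum.inr k then X (⟨v, h⟩ : ChartVar k) else 1)) fun z hz => by
      have eval_eq : (fun i : BlowUpVar m => eval z (i.elim (X none ^ a k) fun v => rename some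
          (if h : v ≠ Sum.inl 1 ∧ v ≠ Sum.inr k then X (⟨v, h⟩ : ChartVar k) else 1))) =
          liftedChartPoint (a k) z := by
        funext i
        cases i with
        | none => simp [liftedChartPoint]
        | some v => exact (eval_rename _ _ _).trans (eval_dite_X _ v)
      simp only [eval_eq]
      exact ⟨liftedChartPoint_mem_stableLocus (mem_stableLocus_span_X_some.1 hz), rfl⟩

section ExponentVectors

variable {S : Finset (Option (ChartVar k) →₀ ℕ)} {d d' : Option (ChartVar k) →₀ ℕ}

theorem SameWeight.sum_chartType_modEq
    (hS : SameWeight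
      (weightedBlowUpGroup (a k) (chartType a k) fun v => blowUpWeight k b v.1) S)
    (hak : a k ≠ 0) (hd : d ∈ S) (hd' : d' ∈ S) :
    ∑ v, chartType a k v * d (some v) ≡ ∑ v, chartType a k v * d' (some v) [MOD a k] := by
  simpa [Fintype.sum_option] using hS.modEq hak (c := fun i => i.elim 0 (chartType a k))
    (fun ε hε => ⟨1, ε, hε, by simp, by simp⟩) hd hd'

theorem SameWeight.none_modEq
    (hS : SameWeight
      (weightedBlowUpGroup (a k) (chartType a k) fun v => blowUpWeight k b v.1) S)
    (hak : a k ≠ 0) (hbw : ∀ v, blowUpWeight k b v ≡ fibreDegree a v [MOD a k]) (hd : d ∈ S)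
    (hd' : d' ∈ S) : d none ≡ d' none [MOD a k] := by
  have mem (ε : ℂˣ) (hε : ε ^ a k = 1) : (fun i : Option (ChartVar k) => ε ^ i.elim 1 0) ∈
      weightedBlowUpGroup (a k) (chartType a k) fun v => blowUpWeight k b v.1 := by
    refine ⟨ε⁻¹, ε, hε, fun v => ?_, by simp⟩
    have root_pow : ε ^ blowUpWeight k b v.1 = ε ^ chartType a k v :=
      pow_eq_pow_of_modEq (hbw v.1) hε
    simp [root_pow]
  simpa [Fintype.sum_option] using hS.modEq hak mem hd hd'

end ExponentVectors

theorem isOpenImmersionOn_liftedChart (hak : 0 < a k)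
    (hbw : ∀ v, blowUpWeight k b v ≡ fibreDegree a v [MOD a k]) :
    IsOpenImmersionOn (liftedChart ω a b k) Set.univ := by
  refine isOpenImmersionOn_of_isLocallyPolynomial isTorusInvariant_span_X_some
    isMorphism_liftedChart isOpen_univ (liftedChart_injective hak.ne' hbw).injOn ?_
  rintro S hS w hw w' hw' ⟨-, hww'⟩ ⟨d₀, hd₀, hne⟩
  obtain ⟨E, hE⟩ := exists_monomials_eq_mul_eval (ω := ω) (e := fun d v => d (some v)) hak
    fun d hd d' hd' => hS.sum_chartType_modEq hak.ne' hd hd'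
  refine ⟨X (some (Sum.inl 1)) * X (some (Sum.inr k)) * X none ^ (d₀ none % a k),
    fun d => X none ^ (d none / a k) * rename some (E d), ?_, fun z hz hN => ?_⟩
  · have w_none : w none ^ (d₀ none % a k) ≠ 0 := by
      rw [Fintype.prod_option, pow_eq_pow_mod_mul_pow_div (n := a k) rfl] at hne
      exact left_ne_zero_of_mul (left_ne_zero_of_mul hne)
    obtain ⟨t, -, rfl⟩ := quotientSpace.mk_eq_mk.1 hww'
    simp only [map_mul, map_pow, eval_X]
    refine mul_ne_zero (by simp [liftedChartPoint, Units.smul_def]) ?_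
    rw [Pi.smul_apply', Units.smul_def, smul_eq_mul, mul_pow]
    refine mul_ne_zero (pow_ne_zero _ (t none).ne_zero) ?_
    simpa only [liftedChartPoint, Option.elim_none, pow_right_comm] using pow_ne_zero (a k) w_none
  · simp only [map_mul, map_pow, eval_X] at hN
    obtain ⟨u, hu⟩ := IsAlgClosed.exists_pow_nat_eq (z none) hak
    obtain ⟨g, hg, v, hv, μ, hμ, h⟩ := hE (fun v => z (some v))
      (left_ne_zero_of_mul (left_ne_zero_of_mul hN)) (right_ne_zero_of_mul (left_ne_zero_of_mul hN))
    obtain ⟨hst, hzst⟩ := exists_liftedChart_mk_eq hz hg hv hu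
    refine ⟨_, hst, ⟨trivial, hzst⟩, μ * u ^ (d₀ none % a k), mul_ne_zero hμ ?_, fun d hd => ?_⟩
    · have := right_ne_zero_of_mul hN
      rw [← hu, pow_right_comm] at this
      exact (pow_ne_zero_iff hak.ne').1 this
    · have pow_none : u ^ d none = u ^ (d₀ none % a k) * z none ^ (d none / a k) := by
        rw [← hS.none_modEq hak.ne' hbw hd hd₀, pow_eq_pow_mod_mul_pow_div hu]
      rw [Fintype.prod_option, Option.elim_none, pow_none, map_mul, map_pow, eval_X, eval_rename]
      simp only [Option.elim_some, h d hd, Function.comp_def]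
      ring

theorem blowDown_liftedChart {hak : a k ≠ 0}
    {hbw : ∀ v, blowUpWeight k b v ≡ fibreDegree a v [MOD a k]} (z : Option (ChartVar k) → ℂ) (hz) :
    blowDown hak hbw (liftedChart ω a b k (quotientSpace.mk z hz)) =
      chart ω a k (cyclicQuotient.mk fun v => z none ^ blowUpWeight k b v.1 * z (some v)) := by
  have chart_eq : blowDownPoint k b (liftedChartPoint (a k) z) (z none) =
      chartPoint fun v => z none ^ blowUpWeight k b v.1 * z (some v) :=
    eq_chartPoint_iff.2 ⟨by simp [blowDownPoint, liftedChartPoint, blowUpWeight],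
      by simp [blowDownPoint, liftedChartPoint, blowUpWeight],
      fun v => by simp [blowDownPoint, liftedChartPoint]⟩
  refine (blowDown_mk _ rfl).trans (quotientSpace.mk_eq_mk.2 ⟨1, one_mem _, ?_⟩)
  rw [chart_eq, one_smul]

theorem range_liftedChart {hak : a k ≠ 0}
    {hbw : ∀ v, blowUpWeight k b v ≡ fibreDegree a v [MOD a k]} :
    Set.range (liftedChart ω a b k) = blowDown hak hbw ⁻¹' Set.range (chart ω a k) := by
  ext x
  induction x using quotientSpace.ind with
  | h z hz =>
    obtain ⟨ζ, hζ⟩ := IsAlgClosed.exists_pow_nat_eq (z none) (Nat.pos_of_ne_zero hak)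
    rw [mk_mem_range_liftedChart_iff (Nat.pos_of_ne_zero hak), Set.mem_preimage,
      blowDown_mk hz hζ, mk_mem_range_chart_iff (Nat.pos_of_ne_zero hak)]
    simp [blowDownPoint, blowUpWeight]

theorem isWeightedBlowUp_blowDown (hak : a k ≠ 0)
    (hbw : ∀ v, blowUpWeight k b v ≡ fibreDegree a v [MOD a k]) (hb : ∀ i, 0 < b i) :
    IsWeightedBlowUp (blowDown (ω := ω) hak hbw)
      (quotientSpace.mk (basePoint k) basePoint_mem_stableLocus) (chart ω a k)
      (fun v => blowUpWeight k b v.1) where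
  chart := isOpenImmersionOn_chart (Nat.pos_of_ne_zero hak)
  chart_zero := quotientSpace.mk_eq_mk.2
    ⟨1, one_mem _, by rw [basePoint_eq_chartPoint_zero, one_smul]⟩
  weight_pos v := Nat.pos_of_ne_zero ((blowUpWeight_ne_zero_iff hb).2 v.2)
  weight_mem := ⟨1, fun v => by rw [one_mul]; exact hbw v.1⟩
  iso_off := isOpenImmersionOn_blowDown hb
  surjective := blowDown_surjective hb
  model := ⟨liftedChart ω a b k, isOpenImmersionOn_liftedChart (Nat.pos_of_ne_zero hak) hbw,
    range_liftedChart, blowDown_liftedChart⟩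

end LiftedChart

theorem WellFormed.ne_zero {m : ℕ} {a : Fin (m + 1) → ℕ} (h : WellFormed a) : m ≠ 0 := by
  rintro rfl
  simpa using h 0

end ToricBlowUp

open ToricBlowUp in
theorem proposition3p4_general {m : ℕ} (ω : Fin (m + 1) → ℕ) {a b : Fin (m + 1) → ℕ}
    {k : Fin (m + 1)} (hm : m ≠ 0) (ha0 : a 0 = 1) (ha : ∀ i, 0 < a i) (hb : ∀ i, 0 < b i)
    (hbi : ∀ i, i ≠ k → b i ≡ a i [MOD a k]) (hbk : a k ∣ b k) :
    (bundleFan ω a).IsFan ∧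
    (bundleFan ω a).irrelevantIdeal = (weightedBundle ω a).irrelevantIdeal ∧
    (bundleFan ω a).coxGroup = (weightedBundle ω a).group ∧
    Function.Injective (weightHom (weightedBundle ω a).weights) ∧
    ((rankThreeStack ω a k b).weights.map (Int.cast : ℤ → ℚ)).rank = 3 ∧
    (∃ γ : Fin (m + 1) → ℤ,
      (a k : ℤ) • γ = ∑ v, (blowUpWeight k b v : ℤ) • (bundleFan ω a).ray v ∧
      ((bundleFan ω a).starSubdivision γ).IsFan ∧
      ((bundleFan ω a).starSubdivision γ).irrelevantIdeal =
        (rankThreeStack ω a k b).irrelevantIdeal ∧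
      ((bundleFan ω a).starSubdivision γ).coxGroup = (rankThreeStack ω a k b).group) ∧
    IsCyclic (weightHom (rankThreeStack ω a k b).weights).ker ∧
    Nat.card (weightHom (rankThreeStack ω a k b).weights).ker = a k ∧
    ∃ (π : (rankThreeStack ω a k b).variety → (weightedBundle ω a).variety)
      (p : (weightedBundle ω a).variety)
      (φ : cyclicQuotient (a k) (chartType a k) → (weightedBundle ω a).variety),
      (∃ h, p = quotientSpace.mk (basePoint k) h) ∧
      (∀ z, ∃ h, φ (cyclicQuotient.mk z) = quotientSpace.mk (chartPoint z) h) ∧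
      (∀ z hz, ∀ ζ : ℂ, ζ ^ a k = z none → ∃ h, π (quotientSpace.mk z hz) =
        quotientSpace.mk (fun v => ζ ^ blowUpWeight k b v * z (some v)) h) ∧
      (∀ z hz, π (quotientSpace.mk z hz) = p ↔ z none = 0) ∧
      IsWeightedBlowUp π p φ (fun v => blowUpWeight k b v.1) := by
  have hak : a k ≠ 0 := (ha k).ne'
  have hbw := blowUpWeight_modEq_fibreDegree hbi hbk
  obtain ⟨γ, hγ⟩ := exists_smul_eq_sum_blowUpWeight_smul_ray (ω := ω) ha0 hbw
  exact ⟨isFan_bundleFan hm ha0 ha, irrelevantIdeal_bundleFan, coxGroup_bundleFan ha0,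
    weightHom_weightedBundle_injective ha0, rank_weights_rankThreeStack hak,
    ⟨γ, hγ, isFan_starSubdivision_bundleFan hm ha0 ha hb hγ,
      irrelevantIdeal_starSubdivision_bundleFan hm ha0 ha hb hγ,
      coxGroup_starSubdivision_bundleFan ha0 (ha k) hb hγ⟩,
    isCyclic_ker_weightHom_rankThreeStack ha0 (ha k) hbw,
    card_ker_weightHom_rankThreeStack ha0 (ha k) hbw,
    blowDown hak hbw, quotientSpace.mk (basePoint k) basePoint_mem_stableLocus, chart ω a k,
    ⟨_, rfl⟩, fun z => ⟨_, chart_mk z _⟩, fun z hz ζ hζ => ⟨_, blowDown_mk hz hζ⟩,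
    fun z hz => blowDown_mk_eq_basePoint_iff hb hz, isWeightedBlowUp_blowDown hak hbw hb⟩

theorem proposition3p4 (m : ℕ) (ω a : Fin (m + 1) → ℕ) (ha0 : a 0 = 1) (ha : ∀ i, 0 < a i)
    (hwf : ToricBlowUp.WellFormed a) (k : Fin (m + 1)) (b : Fin (m + 1) → ℕ) (hb : ∀ i, 0 < b i)
    (hbi : ∀ i, i ≠ k → b i ≡ a i [MOD a k]) (hbk : ∃ r : ℕ, 0 < r ∧ b k = r * a k) :
    -- the fan of `F`, and the Cox data of `F`
    (ToricBlowUp.bundleFan ω a).IsFan ∧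
    (ToricBlowUp.bundleFan ω a).irrelevantIdeal =
      (ToricBlowUp.weightedBundle ω a).irrelevantIdeal ∧
    (ToricBlowUp.bundleFan ω a).coxGroup = (ToricBlowUp.weightedBundle ω a).group ∧
    Function.Injective (ToricBlowUp.weightHom (ToricBlowUp.weightedBundle ω a).weights) ∧
    -- `T` has rank 3 and is given by the star subdivision of the fan of `F` at a lattice vector `γ`
    -- in the interior of the cone of the point
    ((ToricBlowUp.rankThreeStack ω a k b).weights.map (Int.cast : ℤ → ℚ)).rank = 3 ∧
    (∃ γ : Fin (m + 1) → ℤ,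
      (a k : ℤ) • γ =
        ∑ v, (ToricBlowUp.blowUpWeight k b v : ℤ) • (ToricBlowUp.bundleFan ω a).ray v ∧
      ((ToricBlowUp.bundleFan ω a).starSubdivision γ).IsFan ∧
      ((ToricBlowUp.bundleFan ω a).starSubdivision γ).irrelevantIdeal =
        (ToricBlowUp.rankThreeStack ω a k b).irrelevantIdeal ∧
      ((ToricBlowUp.bundleFan ω a).starSubdivision γ).coxGroup =
        (ToricBlowUp.rankThreeStack ω a k b).group) ∧
    IsCyclic (ToricBlowUp.weightHom (ToricBlowUp.rankThreeStack ω a k b).weights).ker ∧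
    Nat.card (ToricBlowUp.weightHom (ToricBlowUp.rankThreeStack ω a k b).weights).ker = a k ∧
    -- the blow up morphism
    ∃ (π : (ToricBlowUp.rankThreeStack ω a k b).variety →
        (ToricBlowUp.weightedBundle ω a).variety)
      (p : (ToricBlowUp.weightedBundle ω a).variety)
      (φ : ToricBlowUp.cyclicQuotient (a k) (ToricBlowUp.chartType a k) →
        (ToricBlowUp.weightedBundle ω a).variety),
      (∃ h, p = ToricBlowUp.quotientSpace.mk (ToricBlowUp.basePoint k) h) ∧
      (∀ z, ∃ h, φ (ToricBlowUp.cyclicQuotient.mk z) =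
        ToricBlowUp.quotientSpace.mk (ToricBlowUp.chartPoint z) h) ∧
      (∀ z hz, ∀ ζ : ℂ, ζ ^ a k = z none → ∃ h,
        π (ToricBlowUp.quotientSpace.mk z hz) =
          ToricBlowUp.quotientSpace.mk
            (fun v => ζ ^ ToricBlowUp.blowUpWeight k b v * z (some v)) h) ∧
      (∀ z hz, π (ToricBlowUp.quotientSpace.mk z hz) = p ↔ z none = 0) ∧
      ToricBlowUp.IsWeightedBlowUp π p φ (fun v => ToricBlowUp.blowUpWeight k b v.1) := by
  obtain ⟨_, _, hr⟩ := hbk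
  exact proposition3p4_general ω hwf.ne_zero ha0 ha hb hbi (Dvd.intro_left _ hr.symm)
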